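/- Let $G$ be a finite tree with shortest-path distance $d$. For a sequence of vertices put $\ell(x_0,\dots,x_k)=\sum_{i<k}d(x_i,x_{i+1})$, and let $I_{k,l}$ be the set of sequences $(x_0,\dots,x_k)\in V(G)^{k+1}$ with $x_i\ne x_{i+1}$ for all $i$ and $\ell(x_0,\dots,x_k)=l$. The magnitude chain complex $MC_{*,l}(G)$ has $MC_{k,l}(G)=\mathbb Z I_{k,l}$ with $\partial(x_0,\dots,x_k)=\sum_{i=1}^{k-1}(-1)^i\partial_i(x_0,\dots,x_k)$, where $\partial_i$ omits $x_i$ if this does not change $\ell$ and is $0$ otherwise; $MH_{k,l}(G)=H_k(MC_{*,l}(G))$. Below, a sequence is an element of some $I_{k,l}$. Let $\Gamma$ be the directed graph on all sequences with an edge $x\to y$ when $y$ has non-zero coefficient in $\partial x$. A matching $M$ is a set of edges of $\Gamma$, no two sharing a vertex; it is a Morse matching if reversing the edges in $M$ makes $\Gamma$ acyclic. A sequence has state insert$(i,v)$ if it is matched to $(x_0,\dots,x_i,v,x_{i+1},\dots,x_k)$, state delete$(i)$ if it is matched to $(x_0,\dots,\widehat{x_i},\dots,x_k)$, and is unmatched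 if it lies on no edge of $M$. A prefix matching is a matching in which a state insert$(i,v)$ or delete$(i)$ of a sequence is shared by all sequences with the same first entries $x_0,\dots,x_{i+1}$. A matching rule $F$ assigns to each sequence one of the symbols $\epsilon$, $\iota(v)$ ($v\in V(G)$), $\delta$. It is valid if * $F(x_0,\dots,x_k)=\iota(v)$ implies that $k\ge 1$, $v\ne x_{k-1},x_k$, $d(x_{k-1},v)+d(v,x_k)=d(x_{k-1},x_k)$, $F(x_0,\dots,x_{k-1},v)=\epsilon$ and $F(x_0,\dots,x_{k-1},v,x_k)=\delta$; * $F(x_0,\dots,x_k)=\delta$ implies that $k\ge2$, $d(x_{k-2},x_{k-1})+d(x_{k-1},x_k)=d(x_{k-2},x_k)$ and $F(x_0,\dots,x_{k-2},x_k)=\iota(x_{k-1})$. A prefix matching is generated by $F$ if, for every sequence $(x_0,\dots,x_k)$ with $k\ge1$ and unmatched $(x_0,\dots,x_{k-1})$, the sequence has state insert$(k-1,v)$ iff $F(x_0,\dots,x_k)=\iota(v)$, and state delete$(k-1)$ iff $F(x_0,\dots,x_k)=\delta$. A valid rule $F$ is diagonal if $F(x_0,\dots,x_k)\neq\epsilon$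 whenever $k\ge 1$, $(x_0,\dots,x_{k-1})$ is unmatched in the prefix matching generated by $F$, and $d(x_{k-1},x_k)\ge2$. Then the following hold. 1. $G$ is diagonal: $MH_{k,l}(G)\ne0$ only if $k=l$. 2. For all vertices $u,v$ with $d(u,v)\ge 2$ there is a unique vertex $\sigma(u,v)=w$ with $d(u,w)=1$ and $d(u,v)=d(u,w)+d(w,v)$. 3. Define $F$ as follows. Let $R(x_0,\dots,x_k)=\delta$ if $k\ge2$, $d(x_{k-2},x_k)\ge 2$ and $x_{k-1}=\sigma(x_{k-2},x_k)$; otherwise $R(x_0,\dots,x_k)=\iota(\sigma(x_{k-1},x_k))$ if $k\ge1$ and $d(x_{k-1},x_k)\ge2$; otherwise $R(x_0,\dots,x_k)=\epsilon$. Let $F(x_0,\dots,x_k)=R(x_0,\dots,x_k)$ if $R(x_0,\dots,x_j)=\epsilon$ for all $j<k$, and $F(x_0,\dots,x_k)=\epsilon$ otherwise. Then $F$ is a diagonal (in particular valid) matching rule, and there is exactly one prefix matching $M$ generated by $F$. Moreover $F(x_0,\dots,x_k)=R(x_0,\dots,x_k)$ if $k=0$ or $(x_0,\dots,x_{k-1})$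 is unmatched in $M$, and $F(x_0,\dots,x_k)=\epsilon$ otherwise. 4. $M$ is a Morse matching. Its unmatched sequences are exactly the sequences $(v)$ with $v\in V(G)$ and the alternating sequences $(u,v,u,\dots)$ with $k+1$ entries, where $u,v$ are adjacent and $k\ge1$. 5. For all $k,l$, the unmatched sequences in $I_{k,l}$ are cycles in $MC_{k,l}(G)$, and their homology classes form a $\mathbb Z$-basis of $MH_{k,l}(G)$. -/

import Mathlib

noncomputable section

namespace MagnitudeTree

open CategoryTheory

universe u

variable {V : Type u}

/-! ### Sequences of vertices and the magnitude chain complex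

A sequence `(x₀, …, x_k)` is the list `[x₀, …, x_k]`, of length `k + 1`. -/

/-- `ℓ(x₀, …, x_k) = ∑ d(x_i, x_{i+1})`, for the shortest path distance with values in `ℕ∞`
(so that it is a genuine extended metric on every graph, and finite on connected ones). -/
def seqLength (G : SimpleGraph V) : List V → ℕ∞
  | [] => 0
  | [_] => 0
  | a :: b :: t => G.edist a b + seqLength G (b :: t)

/-- Membership in `I_{k,l}(G)`: the list is `(x₀, …, x_k)` with `x_i ≠ x_{i+1}` for all `i` and
`ℓ(x₀, …, x_k) = l`. -/
def IsIndex (G : SimpleGraph V) (k l : ℕ) (x : List V) : Prop :=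
  x.length = k + 1 ∧ x.IsChain (· ≠ ·) ∧ seqLength G x = (l : ℕ∞)

/-- The index set `I_{k,l}(G)`. -/
abbrev Idx (G : SimpleGraph V) (k l : ℕ) : Type u := {x : List V // IsIndex G k l x}

/-- The free abelian group `MC_{k,l}(G)` on `I_{k,l}(G)`. -/
abbrev MC (G : SimpleGraph V) (k l : ℕ) : Type u := Idx G k l →₀ ℤ

open scoped Classical in
/-- The generator `x` of `MC_{k,l}(G)` if `x` lies in `I_{k,l}(G)`, and `0` otherwise. -/
def gen (G : SimpleGraph V) (k l : ℕ) (x : List V) : MC G k l :=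
  if h : IsIndex G k l x then Finsupp.single ⟨x, h⟩ 1 else 0

/-- `∂_i(x₀, …, x_{k+1})`: the sequence with `x_i` omitted if this has the same length `ℓ`, and `0`
otherwise. (If the length is the same, then the shorter sequence automatically has distinct
consecutive entries, see `isIndex_eraseIdx_iff`.) -/
def face (G : SimpleGraph V) (k l : ℕ) (i : ℕ) (x : List V) : MC G k l :=
  gen G k l (x.eraseIdx i)

/-- The differential `∂ = ∑_{1 ≤ i ≤ k} (-1)^i ∂_i : MC_{k+1,l}(G) → MC_{k,l}(G)`. -/
def boundary (G : SimpleGraph V) (k l : ℕ) : MC G (k + 1) l →ₗ[ℤ] MC G k l :=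
  Finsupp.linearCombination ℤ fun x : Idx G (k + 1) l =>
    ∑ i ∈ Finset.Icc 1 k, (-1 : ℤ) ^ i • face G k l i x.1

theorem seqLength_eraseIdx_le (G : SimpleGraph V) (x : List V) (i : ℕ) :
    seqLength G (x.eraseIdx i) ≤ seqLength G x := by
  induction x generalizing i with
  | nil => simp [seqLength]
  | cons a t ih =>
    match t, i with
    | [], 0 => simp [seqLength]
    | [], i + 1 => simp [seqLength]
    | b :: t, 0 => simp [seqLength]
    | [b], 1 => simp [seqLength]
    | b :: c :: t, 1 =>
      simp only [List.eraseIdx_cons_succ, List.eraseIdx_cons_zero, seqLength]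
      rw [← add_assoc]
      gcongr
      exact G.edist_triangle
    | b :: t, i + 2 =>
      have h := ih (i + 1)
      simp only [List.eraseIdx_cons_succ, seqLength] at h ⊢
      gcongr

theorem isChain_eraseIdx (G : SimpleGraph V) (x : List V) (i : ℕ) (hx : x.IsChain (· ≠ ·))
    (hfin : seqLength G x ≠ ⊤) (h : seqLength G (x.eraseIdx i) = seqLength G x) :
    (x.eraseIdx i).IsChain (· ≠ ·) := by
  induction x generalizing i with
  | nil => simp
  | cons a t ih =>
    match t, i with
    | [], 0 => simp
    | [], i + 1 => simp
    | b :: t, 0 => simpa using (List.isChain_cons_cons.1 hx).2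
    | [b], 1 => simp
    | b :: c :: t, 1 =>
      simp only [List.eraseIdx_cons_succ, List.eraseIdx_cons_zero, seqLength] at h hfin ⊢
      rw [List.isChain_cons_cons, List.isChain_cons_cons] at hx
      refine List.isChain_cons_cons.2 ⟨?_, hx.2.2⟩
      rintro rfl
      rw [← add_assoc] at h hfin
      have hS : seqLength G (a :: t) ≠ ⊤ := fun h' => hfin (by rw [h']; simp)
      have h0 : G.edist a a = G.edist a b + G.edist b a :=
        ENat.add_left_injective_of_ne_top hS h
      rw [SimpleGraph.edist_self] at h0
      exact hx.1 (SimpleGraph.edist_eq_zero_iff.1 (add_eq_zero.1 h0.symm).1)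
    | b :: t, i + 2 =>
      have h' := ih (i + 1)
      simp only [List.eraseIdx_cons_succ, seqLength] at h h' hfin ⊢
      rw [List.isChain_cons_cons] at hx
      have hab : G.edist a b ≠ ⊤ := fun e => hfin (by rw [e]; simp)
      have hS : seqLength G (b :: t) ≠ ⊤ := fun e => hfin (by rw [e]; simp)
      exact List.isChain_cons_cons.2
        ⟨hx.1, h' hx.2 hS (ENat.add_right_injective_of_ne_top hab h)⟩

theorem isIndex_eraseIdx_iff (G : SimpleGraph V) {k l : ℕ} {x : List V} (hx : IsIndex G (k + 1) l x)
    {i : ℕ} (hi : i ≤ k + 1) :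
    IsIndex G k l (x.eraseIdx i) ↔ seqLength G (x.eraseIdx i) = seqLength G x := by
  obtain ⟨h1, h2, h3⟩ := hx
  constructor
  · intro h
    rw [h.2.2, h3]
  · intro h
    refine ⟨?_, isChain_eraseIdx G x i h2 (by simp [h3]) h, by rw [h, h3]⟩
    rw [List.length_eraseIdx_of_lt (by omega)]
    omega

theorem boundary_gen (G : SimpleGraph V) {k l : ℕ} {x : List V} (hx : IsIndex G (k + 1) l x) :
    boundary G k l (gen G (k + 1) l x) =
      ∑ i ∈ Finset.Icc 1 k, (-1 : ℤ) ^ i • gen G k l (x.eraseIdx i) := by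
  simp [gen, boundary, hx, face]

theorem eraseIdx_eraseIdx_comm (x : List V) {i j : ℕ} (h : i ≤ j) :
    (x.eraseIdx i).eraseIdx j = (x.eraseIdx (j + 1)).eraseIdx i := by
  apply List.ext_getElem?
  intro n
  simp only [List.getElem?_eraseIdx]
  grind

theorem boundary_boundary_gen (G : SimpleGraph V) {k l : ℕ} {x : List V}
    (hx : IsIndex G (k + 2) l x) {i : ℕ} (hi : i ∈ Finset.Icc 1 (k + 1)) :
    boundary G k l (gen G (k + 1) l (x.eraseIdx i)) =
      ∑ j ∈ Finset.Icc 1 k, (-1 : ℤ) ^ j • gen G k l ((x.eraseIdx i).eraseIdx j) := by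
  by_cases h : IsIndex G (k + 1) l (x.eraseIdx i)
  · exact boundary_gen G h
  · have h0 : gen G (k + 1) l (x.eraseIdx i) = 0 := by simp [gen, h]
    rw [h0, map_zero, eq_comm]
    refine Finset.sum_eq_zero fun j hj => ?_
    have : ¬ IsIndex G k l ((x.eraseIdx i).eraseIdx j) := by
      intro h'
      rw [isIndex_eraseIdx_iff G hx (by rw [Finset.mem_Icc] at hi; omega)] at h
      refine h (le_antisymm (seqLength_eraseIdx_le G x i) ?_)
      rw [hx.2.2, ← h'.2.2]
      exact seqLength_eraseIdx_le G _ j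
    simp [gen, this]

theorem boundary_comp_boundary (G : SimpleGraph V) (k l : ℕ) :
    boundary G k l ∘ₗ boundary G (k + 1) l = 0 := by
  refine Finsupp.lhom_ext' fun x => LinearMap.ext_ring ?_
  have hx : Finsupp.single x (1 : ℤ) = gen G (k + 2) l x.1 := by
    simp [gen, x.2]
  simp only [LinearMap.comp_apply, Finsupp.lsingle_apply, LinearMap.zero_apply]
  rw [hx, boundary_gen G x.2, map_sum]
  simp only [map_smul]
  rw [Finset.sum_congr rfl fun i hi => by rw [boundary_boundary_gen G x.2 hi]]
  simp only [Finset.smul_sum, smul_smul, ← pow_add]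
  rw [← Finset.sum_product']
  refine Finset.sum_involution
    (fun p _ => if p.1 ≤ p.2 then (p.2 + 1, p.1) else (p.2, p.1 - 1)) ?_ ?_ ?_ ?_
  · rintro ⟨i, j⟩ hp
    by_cases h : i ≤ j
    · simp only [h, if_true]
      rw [eraseIdx_eraseIdx_comm x.1 h, ← add_smul]
      have : (-1 : ℤ) ^ (i + j) + (-1) ^ (j + 1 + i) = 0 := by ring
      rw [this, zero_smul]
    · simp only [h, if_false]
      obtain ⟨m, rfl⟩ : ∃ m, i = m + 1 := ⟨i - 1, by omega⟩
      have hm : j ≤ m := by omega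
      simp only [Nat.add_sub_cancel]
      rw [eraseIdx_eraseIdx_comm x.1 hm, ← add_smul]
      have : (-1 : ℤ) ^ (m + 1 + j) + (-1) ^ (j + m) = 0 := by ring
      rw [this, zero_smul]
  · rintro ⟨i, j⟩ hp -
    simp only [ne_eq]
    split_ifs <;> simp only [Prod.mk.injEq] <;> omega
  · rintro ⟨i, j⟩ hp
    simp only [Finset.mem_product, Finset.mem_Icc] at hp ⊢
    split_ifs <;> simp only <;> omega
  · rintro ⟨i, j⟩ hp
    simp only
    split_ifs <;> simp_all <;> omega

/-- The magnitude chain complex `MC_{*,l}(G)`. -/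
def magnitudeComplex (G : SimpleGraph V) (l : ℕ) : ChainComplex (ModuleCat.{u} ℤ) ℕ :=
  ChainComplex.of (fun k => ModuleCat.of ℤ (MC G k l))
    (fun k => ModuleCat.ofHom (boundary G k l))
    (fun k => by
      rw [← ModuleCat.ofHom_comp, boundary_comp_boundary]
      rfl)

/-- The magnitude homology `MH_{k,l}(G) = H_k(MC_{*,l}(G))`. -/
abbrev MH (G : SimpleGraph V) (k l : ℕ) : ModuleCat.{u} ℤ := (magnitudeComplex G l).homology k

/-- `MH_{k,l}(G) ≠ 0` only if `k = l`. -/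
def IsDiagonal (G : SimpleGraph V) : Prop :=
  ∀ k l : ℕ, Nontrivial (MH G k l) → k = l

/-- The chain `c` is a cycle, and `h` is its homology class. -/
def IsHomologyClass (G : SimpleGraph V) {k l : ℕ} (c : MC G k l) (h : MH G k l) : Prop :=
  ∃ z : (magnitudeComplex G l).cycles k,
    (magnitudeComplex G l).iCycles k z = c ∧ (magnitudeComplex G l).homologyπ k z = h

/-! ### Matchings of the magnitude chain complex -/

/-- The list is a sequence, i.e. lies in `I_{k,l}(G)` for some `k` and `l`. -/
def IsSeq (G : SimpleGraph V) (x : List V) : Prop := ∃ k l : ℕ, IsIndex G k l x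

/-- The edges `x → y` of the directed graph of the complexes `MC_{*,l}(G)`, for all `l` at once:
the coefficient of `y` in `∂ x` is not zero. -/
def Edge (G : SimpleGraph V) (x y : List V) : Prop :=
  ∃ (k l : ℕ) (a : Idx G (k + 1) l) (b : Idx G k l),
    a.1 = x ∧ b.1 = y ∧ boundary G k l (Finsupp.single a 1) b ≠ 0

/-- A (not necessarily perfect) matching, as a set of edges: every sequence lies on at most one
edge of `M`. -/
structure IsMatching (G : SimpleGraph V) (M : List V → List V → Prop) : Prop where
  edge : ∀ x y, M x y → Edge G x y
  target_unique : ∀ x y y', M x y → M x y' → y = y'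
  source_unique : ∀ x x' y, M x y → M x' y → x = x'
  source_target : ∀ x y z, M x y → ¬ M y z

/-- The matching `M` is a Morse matching: reversing the edges of `M` gives an acyclic graph. -/
def IsMorseMatching (G : SimpleGraph V) (M : List V → List V → Prop) : Prop :=
  IsMatching G M ∧
    ∀ x, ¬ Relation.TransGen (fun a b => (Edge G a b ∧ ¬ M a b) ∨ M b a) x x

/-- The matching state "unmatched". -/
def Unmatched (M : List V → List V → Prop) (x : List V) : Prop :=
  ∀ y, ¬ M x y ∧ ¬ M y x

/-- The matching state insert(`i`, `v`): `x` is matched to `(x₀, …, x_i, v, x_{i+1}, …, x_k)`. -/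
def HasInsert (M : List V → List V → Prop) (x : List V) (i : ℕ) (v : V) : Prop :=
  i + 1 < x.length ∧ M (x.insertIdx (i + 1) v) x

/-- The matching state delete(`i`): `x` is matched to `x` with `x_i` omitted. -/
def HasDelete (M : List V → List V → Prop) (x : List V) (i : ℕ) : Prop :=
  i < x.length ∧ M x (x.eraseIdx i)

/-- Prefix matchings: a matching state insert(`i`, `v`) or delete(`i`) of a sequence is shared by
all sequences with the same `(x₀, …, x_{i+1})`. -/
structure IsPrefixMatching (G : SimpleGraph V) (M : List V → List V → Prop) : Prop where
  isMatching : IsMatching G M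
  insert_of_prefix : ∀ x y i v, HasInsert M x i v → IsSeq G y → x.take (i + 2) <+: y →
    HasInsert M y i v
  delete_of_prefix : ∀ x y i, HasDelete M x i → IsSeq G y → x.take (i + 2) <+: y →
    HasDelete M y i

/-- The values `ε`, `ι(v)`, `δ` of a matching rule. -/
inductive RuleValue (V : Type u) : Type u
  | idle : RuleValue V
  | insert : V → RuleValue V
  | delete : RuleValue V

/-- The matching `M` is generated by the matching rule `F`: if `(x₀, …, x_{k-1})` (the list `p`)
is unmatched, then `(x₀, …, x_k)` has state insert(`k - 1`, `v`) iff `F` has value `ι(v)` on it, and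
delete(`k - 1`) iff `F` has value `δ` on it. -/
def IsGeneratedBy (G : SimpleGraph V) (F : List V → RuleValue V) (M : List V → List V → Prop) :
    Prop :=
  ∀ (p : List V) (b : V), p ≠ [] → IsSeq G (p ++ [b]) → Unmatched M p →
    (∀ v, HasInsert M (p ++ [b]) (p.length - 1) v ↔ F (p ++ [b]) = .insert v) ∧
    (HasDelete M (p ++ [b]) (p.length - 1) ↔ F (p ++ [b]) = .delete)

/-- Valid matching rules. The letters `a b c` stand for the last entries of the sequence. -/
structure IsValidRule (G : SimpleGraph V) (F : List V → RuleValue V) : Prop where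
  of_insert : ∀ x v, IsSeq G x → F x = .insert v →
    ∃ p a b, x = p ++ [a, b] ∧ v ≠ a ∧ v ≠ b ∧ G.dist a v + G.dist v b = G.dist a b ∧
      F (p ++ [a, v]) = .idle ∧ F (p ++ [a, v, b]) = .delete
  of_delete : ∀ x, IsSeq G x → F x = .delete →
    ∃ p a b c, x = p ++ [a, b, c] ∧ G.dist a b + G.dist b c = G.dist a c ∧
      F (p ++ [a, c]) = .insert b

/-- Diagonal matching rules: valid ones with `F(x₀, …, x_k) ≠ ε` whenever `(x₀, …, x_{k-1})` is
unmatched (in the prefix matching generated by `F`) and `d(x_{k-1}, x_k) ≥ 2`. -/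
def IsDiagonalRule (G : SimpleGraph V) (F : List V → RuleValue V) : Prop :=
  IsValidRule G F ∧
    ∀ M, IsPrefixMatching G M → IsGeneratedBy G F M →
      ∀ (q : List V) (a b : V), IsSeq G (q ++ [a, b]) → Unmatched M (q ++ [a]) →
        2 ≤ G.dist a b → F (q ++ [a, b]) ≠ .idle

/-! ### The matching rule of a tree -/

/-- `w` is the first step of a geodesic from `u` to `v`. -/
def IsFirstStep (G : SimpleGraph V) (u v w : V) : Prop :=
  G.dist u w = 1 ∧ G.dist u v = G.dist u w + G.dist w v

open scoped Classical in
/-- `σ(u, v)`: the first step of a geodesic from `u` to `v` (the value is arbitrary if there is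
none). -/
def firstStep (G : SimpleGraph V) (u v : V) : V :=
  if h : ∃ w, IsFirstStep G u v w then h.choose else u

open scoped Classical in
/-- The value of the rule on `(x₀, …, x_k)` when `(x₀, …, x_{k-1})` is unmatched. The list is read
from its end, so that `b = x_k`, `a = x_{k-1}` and `c = x_{k-2}`: the value is `δ` if `k ≥ 2` and
`x_{k-1} = σ(x_{k-2}, x_k)`; otherwise `ι(σ(x_{k-1}, x_k))` if `k ≥ 1` and `d(x_{k-1}, x_k) ≥ 2`;
otherwise `ε`. -/
def treeRuleStep (G : SimpleGraph V) (x : List V) : RuleValue V :=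
  match x.reverse with
  | b :: a :: c :: _ =>
    if 2 ≤ G.dist c b ∧ a = firstStep G c b then .delete
    else if 2 ≤ G.dist a b then .insert (firstStep G a b) else .idle
  | [b, a] => if 2 ≤ G.dist a b then .insert (firstStep G a b) else .idle
  | _ => .idle

open scoped Classical in
/-- The matching rule of a tree: `treeRuleStep` as long as it was `ε` on all proper prefixes, and
`ε` afterwards. -/
def treeRule (G : SimpleGraph V) (x : List V) : RuleValue V :=
  if ∀ p, p <+: x → p ≠ x → treeRuleStep G p = .idle then treeRuleStep G x else .idle

/-- The alternating sequence `(u, v, u, …)` with `k + 1` entries. -/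
def alternating (u v : V) : ℕ → List V
  | 0 => [u]
  | k + 1 => u :: alternating v u k

end MagnitudeTree

end

namespace MagnitudeTree

open CategoryTheory

universe u

variable {V : Type u} {G : SimpleGraph V}

/-! ### Distances in trees -/

/-! The matching is a discrete Morse matching whose critical cells are cycles. Read a sequence from
the left as long as `treeRuleStep` is `ε`. Such an idle prefix has unit steps only, and it must turn
back at each step: in a tree, two unit steps that do not backtrack form a geodesic, whose middle
vertex the rule would delete (`IsIdle.last_eq`). So the idle sequences are the single vertices and
the alternating sequences.

A sequence that is not idle has a unique shortest non-idle prefix. It ends either in a gap `c, b`,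
into which the rule inserts `a = σ(c, b)`, or in `c, a, b` with `a = σ(c, b)`, from which it deletes
`a`. The two cases correspond bijectively (`isDel_iff_isIns`), and this gives the matching. It is
the only prefix matching generated by the rule, since a state is either inherited from a shorter
prefix or prescribed by the rule (`states_of_isGeneratedBy`).

The central computation is `IsDel.exists_eraseIdx`: no interior vertex up to `c` can be omitted, and
the faces after `c` of `(q, c, b, s)` and of `(q, c, a, b, s)` correspond to each other under the
insertion of `a`. Hence deletion type is kept along unmatched edges, which yields acyclicity
(`morseHeight`). The signed insertion `h` satisfies `∂h + h∂ = 1 - π`, where `π` projects to the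
span of the idle sequences (`homotopy_succ`). No interior vertex of an idle sequence can be omitted,
so idle sequences are cycles. Thus they represent a basis of the homology (`exists_basis`), and they
lie in bidegrees `k = l`. -/

theorem exists_isFirstStep (hG : G.Connected) {u v : V} (h : u ≠ v) :
    ∃ w, IsFirstStep G u v w := by
  obtain ⟨p, hp⟩ := hG.exists_walk_length_eq_dist u v
  cases p with
  | nil => exact absurd rfl h
  | @cons _ w _ hadj q =>
    refine ⟨w, SimpleGraph.dist_eq_one_iff_adj.2 hadj, ?_⟩
    have h1 := SimpleGraph.dist_le q
    have h2 := hG.dist_triangle (u := u) (v := w) (w := v)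
    rw [SimpleGraph.Walk.length_cons] at hp
    rw [SimpleGraph.dist_eq_one_iff_adj.2 hadj] at h2 ⊢
    omega

/-- A first step followed by a geodesic to `v` is a walk of length `d(u, v)`, hence a path. A tree
has only one path from `u` to `v`, and the first step is its second vertex. -/
theorem IsFirstStep.unique (hG : G.IsTree) {u v w w' : V} (h : IsFirstStep G u v w)
    (h' : IsFirstStep G u v w') : w = w' := by
  obtain ⟨p, hp⟩ := hG.connected.exists_walk_length_eq_dist w v
  obtain ⟨p', hp'⟩ := hG.connected.exists_walk_length_eq_dist w' v
  obtain ⟨h1, h2⟩ := h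
  obtain ⟨h1', h2'⟩ := h'
  have e := (hG.existsUnique_path u v).unique
    (y₁ := .cons (SimpleGraph.dist_eq_one_iff_adj.1 h1) p)
    (y₂ := .cons (SimpleGraph.dist_eq_one_iff_adj.1 h1') p')
    (SimpleGraph.Walk.isPath_of_length_eq_dist _ (by rw [SimpleGraph.Walk.length_cons]; omega))
    (SimpleGraph.Walk.isPath_of_length_eq_dist _ (by rw [SimpleGraph.Walk.length_cons]; omega))
  simpa using congrArg SimpleGraph.Walk.snd e

theorem isFirstStep_firstStep (hG : G.Connected) {u v : V} (h : u ≠ v) :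
    IsFirstStep G u v (firstStep G u v) := by
  have := exists_isFirstStep hG h
  rw [firstStep, dif_pos this]
  exact this.choose_spec

theorem IsFirstStep.ne {u v w : V} (h : IsFirstStep G u v w) : u ≠ v := by
  rintro rfl
  obtain ⟨h1, h2⟩ := h
  rw [SimpleGraph.dist_self] at h2
  omega

theorem eq_firstStep_iff (hG : G.IsTree) {u v w : V} (h : u ≠ v) :
    w = firstStep G u v ↔ IsFirstStep G u v w :=
  ⟨fun e => e ▸ isFirstStep_firstStep hG.connected h,
    fun h' => h'.unique hG (isFirstStep_firstStep hG.connected h)⟩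

/-- One of two adjacent vertices is the first step from the other one to any vertex. -/
theorem isFirstStep_or_isFirstStep (hG : G.IsTree) {e c : V} (b : V) (h : G.dist e c = 1) :
    IsFirstStep G e b c ∨ IsFirstStep G c b e := by
  have hadj := SimpleGraph.dist_eq_one_iff_adj.1 h
  have h' : G.dist c e = 1 := by rwa [SimpleGraph.dist_comm]
  have := hG.dist_eq_dist_add_one_of_adj b hadj
  rw [SimpleGraph.dist_comm (u := b), SimpleGraph.dist_comm (u := b)] at this
  unfold IsFirstStep
  omega

theorem not_isFirstStep_symm {e c b : V} (h : IsFirstStep G e b c) : ¬ IsFirstStep G c b e := by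
  unfold IsFirstStep at *
  omega

theorem IsFirstStep.of_between (hG : G.Connected) {u v w x : V} (h : IsFirstStep G u v w)
    (hx : G.dist u v + G.dist v x = G.dist u x) : IsFirstStep G u x w := by
  obtain ⟨h1, h2⟩ := h
  have t1 := hG.dist_triangle (u := w) (v := v) (w := x)
  have t2 := hG.dist_triangle (u := u) (v := w) (w := x)
  exact ⟨h1, by omega⟩

/-- Geodesics `c, a, …, b` and `a, …, b, …, x` with `a ≠ b` fit together. -/
theorem IsFirstStep.glue (hG : G.IsTree) {c a b x : V} (h : IsFirstStep G c b a) (hab : a ≠ b)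
    (hx : G.dist a b + G.dist b x = G.dist a x) : IsFirstStep G c x a := by
  refine (isFirstStep_or_isFirstStep hG x h.1).resolve_right fun h' => ?_
  -- If `c` were the first step from `a` to `x`, it would also be the first step from `a` to `b`,
  -- since `b` lies between `a` and `x`. But `a` is the first step from `c` to `b`.
  obtain ⟨f, hf⟩ := exists_isFirstStep hG.connected hab
  have := (hf.of_between hG.connected hx).unique hG h'
  exact not_isFirstStep_symm h (this ▸ hf)

/-! ### Lengths of sequences in connected graphs -/

/-- The length of a sequence, as a natural number. -/
noncomputable def natLength (G : SimpleGraph V) : List V → ℕ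
  | [] => 0
  | [_] => 0
  | a :: b :: t => G.dist a b + natLength G (b :: t)

theorem seqLength_eq_natLength (hG : G.Connected) (x : List V) :
    seqLength G x = natLength G x := by
  induction x with
  | nil => simp [seqLength, natLength]
  | cons a t ih =>
    cases t with
    | nil => simp [seqLength, natLength]
    | cons b t =>
      rw [seqLength, natLength, ih, Nat.cast_add, (hG a b).coe_dist_eq_edist]

theorem natLength_append (q : List V) (c : V) (s : List V) :
    natLength G (q ++ c :: s) = natLength G (q ++ [c]) + natLength G (c :: s) := by
  induction q with
  | nil => simp [natLength]
  | cons a q ih =>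
    cases q with
    | nil => simp [natLength]
    | cons b q =>
      simp only [List.cons_append, natLength] at ih ⊢
      omega

theorem isIndex_iff (hG : G.Connected) {k l : ℕ} {x : List V} :
    IsIndex G k l x ↔ x.length = k + 1 ∧ x.IsChain (· ≠ ·) ∧ natLength G x = l := by
  rw [IsIndex, seqLength_eq_natLength hG, Nat.cast_inj]

theorem isSeq_iff (hG : G.Connected) {x : List V} :
    IsSeq G x ↔ x ≠ [] ∧ x.IsChain (· ≠ ·) := by
  constructor
  · rintro ⟨k, l, h⟩
    refine ⟨?_, h.2.1⟩
    rintro rfl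
    exact absurd h.1 (by simp)
  · rintro ⟨h1, h2⟩
    have := List.length_pos_iff.2 h1
    exact ⟨x.length - 1, natLength G x, (isIndex_iff hG).2 ⟨by omega, h2, rfl⟩⟩

theorem IsSeq.of_prefix (hG : G.Connected) {x y : List V} (hx : IsSeq G x) (h : y <+: x)
    (hy : y ≠ []) : IsSeq G y := by
  rw [isSeq_iff hG] at *
  exact ⟨hy, hx.2.prefix h⟩

/-- Inserting a vertex between its neighbours does not change the index `l`. -/
theorem isIndex_insert_iff (hG : G.Connected) {k l : ℕ} {q s : List V} {e c f : V}
    (hec : e ≠ c) (hcf : c ≠ f) (h : G.dist e c + G.dist c f = G.dist e f) :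
    IsIndex G (k + 1) l (q ++ e :: c :: f :: s) ↔ IsIndex G k l (q ++ e :: f :: s) := by
  have hef : e ≠ f := by
    rintro rfl
    have := hG.pos_dist_of_ne hec
    rw [SimpleGraph.dist_self] at h
    omega
  rw [isIndex_iff hG, isIndex_iff hG, natLength_append, natLength_append q e (f :: s),
    List.isChain_split, List.isChain_split (l₂ := f :: s)]
  simp only [natLength, List.isChain_cons_cons, List.length_append, List.length_cons]
  constructor
  · rintro ⟨h1, ⟨h2, h3, h4, h5⟩, h6⟩
    exact ⟨by omega, ⟨h2, hef, h5⟩, by omega⟩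
  · rintro ⟨h1, ⟨h2, h3, h4⟩, h6⟩
    exact ⟨by omega, ⟨h2, hec, hcf, h4⟩, by omega⟩

theorem between_of_isIndex (hG : G.Connected) {k k' l : ℕ} {q s : List V} {e c f : V}
    (h : IsIndex G k l (q ++ e :: c :: f :: s)) (h' : IsIndex G k' l (q ++ e :: f :: s)) :
    G.dist e c + G.dist c f = G.dist e f := by
  rw [isIndex_iff hG, natLength_append] at h h'
  simp only [natLength] at h h'
  omega

/-! ### Faces of a sequence and edges of the directed graph -/

/-- Equal erasures at `i < j` would have `x_{i+1}` and `x_i` as their entries at place `i`, but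
consecutive entries differ. Hence a face determines the omitted position. -/
theorem eraseIdx_injective_of_isChain {x : List V} (hx : x.IsChain (· ≠ ·)) {i j : ℕ}
    (hi : i < x.length) (hj : j < x.length) (h : x.eraseIdx i = x.eraseIdx j) : i = j := by
  wlog hij : i ≤ j generalizing i j
  · exact (this hj hi h.symm (by omega)).symm
  by_contra hne
  have h1 := congrArg (fun y => y[i]?) h
  simp only [List.getElem?_eraseIdx] at h1
  rw [if_neg (by omega), if_pos (by omega), List.getElem?_eq_getElem (by omega),
    List.getElem?_eq_getElem hi] at h1
  exact List.isChain_iff_getElem.1 hx i (by omega) (Option.some_injective _ h1).symm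

theorem insertIdx_injective_of_isChain {x : List V} {i j : ℕ} {v w : V}
    (hx : (x.insertIdx i v).IsChain (· ≠ ·)) (hi : i ≤ x.length) (hj : j ≤ x.length)
    (h : x.insertIdx i v = x.insertIdx j w) : i = j ∧ v = w := by
  have hij : i = j := by
    refine eraseIdx_injective_of_isChain hx ?_ ?_ ?_
    · rw [List.length_insertIdx_of_le_length hi]; omega
    · rw [List.length_insertIdx_of_le_length hi]; omega
    · rw [List.eraseIdx_insertIdx_self, h, List.eraseIdx_insertIdx_self]
  subst hij
  have h1 := congrArg (fun y => y[i]?) h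
  simp only [List.getElem?_insertIdx_self] at h1
  rw [if_pos hi, if_pos hi] at h1
  exact ⟨rfl, Option.some_injective _ h1⟩

/-- Different positions give different faces, so no two terms of `∂` cancel and every face that is
not zero has coefficient `±1`. -/
theorem edge_iff {x y : List V} :
    Edge G x y ↔ ∃ k l i, IsIndex G (k + 1) l x ∧ IsIndex G k l y ∧ i ∈ Finset.Icc 1 k ∧
      y = x.eraseIdx i := by
  classical
  have key : ∀ (k l : ℕ) (a : Idx G (k + 1) l) (b : Idx G k l),
      boundary G k l (Finsupp.single a 1) b =
        ∑ i ∈ Finset.Icc 1 k, if b.1 = a.1.eraseIdx i then (-1 : ℤ) ^ i else 0 := by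
    intro k l a b
    have ha : Finsupp.single a (1 : ℤ) = gen G (k + 1) l a.1 := by simp [gen, a.2]
    rw [ha, boundary_gen G a.2, Finsupp.finsetSum_apply]
    refine Finset.sum_congr rfl fun i _ => ?_
    rw [Finsupp.smul_apply]
    split_ifs with h
    · rw [← h, gen, dif_pos b.2]
      simp
    · rw [gen]
      split_ifs with h'
      · rw [Finsupp.single_apply, if_neg (fun e => h (by rw [← e])), smul_zero]
      · simp
  constructor
  · rintro ⟨k, l, a, b, rfl, rfl, h⟩
    rw [key] at h
    obtain ⟨i, hi, h⟩ := Finset.exists_ne_zero_of_sum_ne_zero h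
    exact ⟨k, l, i, a.2, b.2, hi, by by_contra h'; simp [h'] at h⟩
  · rintro ⟨k, l, i, hx, hy, hi, rfl⟩
    refine ⟨k, l, ⟨x, hx⟩, ⟨_, hy⟩, rfl, rfl, ?_⟩
    rw [key, Finset.sum_eq_single_of_mem i hi]
    · simp
    · intro j hj hij
      rw [if_neg]
      intro h
      refine hij (eraseIdx_injective_of_isChain hx.2.1 ?_ ?_ h).symm <;>
        · rw [hx.1]
          rw [Finset.mem_Icc] at hi hj
          omega

/-! ### The matching rule of a tree, in terms of the idle prefix of a sequence -/

/-- `treeRuleStep` has the value `ε` on the sequence and on all its prefixes. -/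
def IsIdle (G : SimpleGraph V) (p : List V) : Prop :=
  ∀ r, r <+: p → treeRuleStep G r = .idle

/-- On `(q, c, a, b)` the rule has the value `δ`. -/
structure IsDel (G : SimpleGraph V) (q : List V) (c a b : V) : Prop where
  idle : IsIdle G (q ++ [c, a])
  step : IsFirstStep G c b a
  -- Together with `step`, this amounts to `d(c, b) ≥ 2`.
  ne : a ≠ b

/-- On `(q, c, b)` the rule has the value `ι(a)`. -/
structure IsIns (G : SimpleGraph V) (q : List V) (c a b : V) : Prop where
  idle : IsIdle G (q ++ [c])
  step : IsFirstStep G c b a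
  ne : a ≠ b
  -- The rule tests for `δ` before `ι`, so the vertex `c` must not be deletable.
  last : ∀ q' e, q = q' ++ [e] → ¬ IsFirstStep G e b c

theorem treeRuleStep_nil : treeRuleStep G [] = .idle := by simp [treeRuleStep]

theorem treeRuleStep_singleton (a : V) : treeRuleStep G [a] = .idle := by simp [treeRuleStep]

open scoped Classical in
theorem treeRuleStep_pair (a b : V) : treeRuleStep G [a, b] =
    if 2 ≤ G.dist a b then .insert (firstStep G a b) else .idle := by
  simp [treeRuleStep]

open scoped Classical in
theorem treeRuleStep_append (q : List V) (c a b : V) : treeRuleStep G (q ++ [c, a, b]) =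
    if 2 ≤ G.dist c b ∧ a = firstStep G c b then .delete
    else if 2 ≤ G.dist a b then .insert (firstStep G a b) else .idle := by
  simp [treeRuleStep]

theorem isIdle_append_singleton {p : List V} {b : V} :
    IsIdle G (p ++ [b]) ↔ IsIdle G p ∧ treeRuleStep G (p ++ [b]) = .idle := by
  constructor
  · exact fun h => ⟨fun r hr => h r (hr.trans (List.prefix_append _ _)), h _ List.prefix_rfl⟩
  · rintro ⟨h1, h2⟩ r hr
    rcases List.prefix_concat_iff.1 hr with rfl | hr
    · exact h2
    · exact h1 r hr

theorem IsIdle.of_prefix {p r : List V} (h : IsIdle G p) (hr : r <+: p) : IsIdle G r :=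
  fun _ hs => h _ (hs.trans hr)

theorem isIdle_nil : IsIdle G [] := by
  intro r hr
  rw [List.prefix_nil.1 hr, treeRuleStep_nil]

theorem isIdle_singleton (a : V) : IsIdle G [a] :=
  isIdle_append_singleton (p := []).2 ⟨isIdle_nil, treeRuleStep_singleton a⟩

open scoped Classical in
-- The proper prefixes of `p ++ [b]` are exactly the prefixes of `p`.
theorem treeRule_append_singleton (p : List V) (b : V) : treeRule G (p ++ [b]) =
    if IsIdle G p then treeRuleStep G (p ++ [b]) else .idle := by
  have : (∀ r, r <+: p ++ [b] → r ≠ p ++ [b] → treeRuleStep G r = .idle) ↔ IsIdle G p := by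
    refine forall_congr' fun r => ⟨fun h hr => h (hr.trans (List.prefix_append _ _)) ?_,
      fun h hr hne => h ((List.prefix_concat_iff.1 hr).resolve_left hne)⟩
    rintro rfl
    have := hr.length_le
    simp at this
  rw [treeRule]
  exact if_congr this rfl rfl

/-- A last step of length at least 2 always triggers `δ` or `ι`. -/
theorem IsIdle.dist_eq_one (hG : G.Connected) {q : List V} {e c : V} (h : IsIdle G (q ++ [e, c]))
    (hc : (q ++ [e, c]).IsChain (· ≠ ·)) : G.dist e c = 1 := by
  have hne : e ≠ c := by
    have := (List.isChain_split.1 hc).2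
    simpa using this
  have hpos := hG.pos_dist_of_ne hne
  have hs := h _ List.prefix_rfl
  by_contra h1
  have h2 : 2 ≤ G.dist e c := by omega
  rcases List.eq_nil_or_concat q with rfl | ⟨q, f, rfl⟩
  · rw [List.nil_append, treeRuleStep_pair, if_pos h2] at hs
    cases hs
  · rw [List.concat_append, treeRuleStep_append, if_pos h2] at hs
    split_ifs at hs

/-- Two unit steps `e, c, a` with `a ≠ e` form a geodesic in a tree. Then `c = σ(e, a)`, and the
rule would be `δ`. -/
theorem IsIdle.last_eq (hG : G.IsTree) {q : List V} {e c a : V} (h : IsIdle G (q ++ [e, c, a]))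
    (hc : (q ++ [e, c, a]).IsChain (· ≠ ·)) : a = e := by
  have hp : q ++ [e, c] <+: q ++ [e, c, a] := ⟨[a], by simp⟩
  have h1 := (h.of_prefix hp).dist_eq_one hG.connected (hc.prefix hp)
  have h2 : G.dist c a = 1 := by
    have e1 : q ++ [e, c, a] = q ++ [e] ++ [c, a] := by simp
    rw [e1] at h hc
    exact h.dist_eq_one hG.connected hc
  by_contra hne
  have hea : e ≠ a := Ne.symm hne
  have hpos := hG.connected.pos_dist_of_ne hea
  have hs := h _ List.prefix_rfl
  have hf : IsFirstStep G e a c := by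
    refine (isFirstStep_or_isFirstStep hG a h1).resolve_right fun h3 => ?_
    have := h3.2
    rw [SimpleGraph.dist_comm (u := c) (v := e)] at this
    omega
  rw [treeRuleStep_append, if_pos] at hs
  · cases hs
  · exact ⟨by have := hf.2; omega, (eq_firstStep_iff hG hea).2 hf⟩

theorem two_le_dist_of_isFirstStep (hG : G.Connected) {c a b : V} (h : IsFirstStep G c b a)
    (hab : a ≠ b) : 2 ≤ G.dist c b := by
  have := hG.pos_dist_of_ne hab
  have := h.2
  have := h.1
  omega

theorem ne_of_two_le_dist {c b : V} (h : 2 ≤ G.dist c b) : c ≠ b := by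
  rintro rfl
  rw [SimpleGraph.dist_self] at h
  omega

/-- `a = σ(c, b)` with `d(c, b) ≥ 2`. -/
theorem isFirstStep_and_ne_iff (hG : G.IsTree) {c a b : V} :
    2 ≤ G.dist c b ∧ a = firstStep G c b ↔ IsFirstStep G c b a ∧ a ≠ b := by
  constructor
  · rintro ⟨h1, h2⟩
    have h3 := (eq_firstStep_iff hG (ne_of_two_le_dist h1)).1 h2
    refine ⟨h3, ?_⟩
    rintro rfl
    have := h3.1
    omega
  · rintro ⟨h1, h2⟩
    exact ⟨two_le_dist_of_isFirstStep hG.connected h1 h2, (eq_firstStep_iff hG h1.ne).2 h1⟩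

theorem treeRule_eq_delete_iff (hG : G.IsTree) {q : List V} {c a b : V} :
    treeRule G (q ++ [c, a, b]) = .delete ↔ IsDel G q c a b := by
  have e : q ++ [c, a, b] = (q ++ [c, a]) ++ [b] := by simp
  rw [e, treeRule_append_singleton, ← e, treeRuleStep_append]
  constructor
  · intro h
    split_ifs at h with h1 h2
    obtain ⟨h3, h4⟩ := (isFirstStep_and_ne_iff hG).1 h2
    exact ⟨h1, h3, h4⟩
  · rintro ⟨h1, h2, h3⟩
    rw [if_pos h1, if_pos ((isFirstStep_and_ne_iff hG).2 ⟨h2, h3⟩)]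

theorem treeRule_eq_insert_iff (hG : G.IsTree) {q : List V} {c a b : V} :
    treeRule G (q ++ [c, b]) = .insert a ↔ IsIns G q c a b := by
  have e : q ++ [c, b] = (q ++ [c]) ++ [b] := by simp
  rw [e, treeRule_append_singleton, ← e]
  have key : 2 ≤ G.dist c b ∧ firstStep G c b = a ↔ IsFirstStep G c b a ∧ a ≠ b := by
    rw [eq_comm (b := a), isFirstStep_and_ne_iff hG]
  rcases List.eq_nil_or_concat q with rfl | ⟨q, f, rfl⟩
  · rw [List.nil_append, List.nil_append, treeRuleStep_pair]
    constructor
    · intro h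
      split_ifs at h with h1 h2
      obtain ⟨h3, h4⟩ := key.1 ⟨h2, RuleValue.insert.inj h⟩
      exact ⟨h1, h3, h4, by simp⟩
    · rintro ⟨h1, h2, h3, -⟩
      obtain ⟨h4, h5⟩ := key.2 ⟨h2, h3⟩
      rw [List.nil_append] at h1
      rw [if_pos h1, if_pos h4, h5]
  · rw [List.concat_eq_append, List.append_assoc, List.append_assoc, List.singleton_append,
      List.singleton_append, treeRuleStep_append]
    constructor
    · intro h
      split_ifs at h with h1 h2 h3
      obtain ⟨h4, h5⟩ := key.1 ⟨h3, RuleValue.insert.inj h⟩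
      refine ⟨by simpa using h1, h4, h5, fun q' e he h6 => h2 ?_⟩
      obtain ⟨rfl, rfl⟩ : q = q' ∧ f = e := by simpa using he
      exact (isFirstStep_and_ne_iff hG).2 ⟨h6, ne_of_two_le_dist h3⟩
    · rintro ⟨h1, h2, h3, h4⟩
      obtain ⟨h5, h6⟩ := key.2 ⟨h2, h3⟩
      rw [List.append_assoc, List.singleton_append] at h1
      rw [if_pos h1, if_neg, if_pos h5, h6]
      exact fun h7 => h4 q f rfl ((isFirstStep_and_ne_iff hG).1 h7).1

/-- The insertion and deletion cases of the rule correspond to each other. -/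
theorem isDel_iff_isIns (hG : G.IsTree) {q : List V} {c a b : V}
    (hc : (q ++ [c]).IsChain (· ≠ ·)) : IsDel G q c a b ↔ IsIns G q c a b := by
  have e1 : q ++ [c, a] = (q ++ [c]) ++ [a] := by simp
  constructor
  · rintro ⟨h1, h2, h3⟩
    refine ⟨h1.of_prefix (e1 ▸ List.prefix_append _ _), h2, h3, ?_⟩
    rintro q e rfl h4
    have hca : c ≠ a := fun h => by simpa [h] using h2.1
    have hc' : (q ++ [e, c, a]).IsChain (· ≠ ·) := by
      have e2 : q ++ [e, c, a] = (q ++ [e]) ++ c :: [a] := by simp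
      rw [e2, List.isChain_split]
      exact ⟨hc, by simpa using hca⟩
    have h5 : IsIdle G (q ++ [e, c, a]) := by simpa using h1
    -- Idleness of `(q, e, c, a)` forces `a = e`, and adjacent vertices are not first steps from
    -- each other to the same `b`.
    obtain rfl := h5.last_eq hG hc'
    exact not_isFirstStep_symm h2 h4
  · rintro ⟨h1, h2, h3, h4⟩
    refine ⟨?_, h2, h3⟩
    rw [e1, isIdle_append_singleton, ← e1]
    refine ⟨h1, ?_⟩
    have h5 : ¬ 2 ≤ G.dist c a := by rw [h2.1]; omega
    rcases List.eq_nil_or_concat q with rfl | ⟨q, e, rfl⟩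
    · rw [List.nil_append, treeRuleStep_pair, if_neg h5]
    · rw [List.concat_append, treeRuleStep_append, if_neg, if_neg h5]
      rw [List.concat_append] at h1 hc
      -- As `c` does not lead from `e` to `b`, the vertex `e` leads from `c` to `b`, so `a = e`. The
      -- inserted vertex goes back to `e`, and the rule has no reason to delete `c`.
      have h6 := (isFirstStep_or_isFirstStep hG b (h1.dist_eq_one hG.connected hc)).resolve_left
        (h4 q e (by simp))
      obtain rfl := h6.unique hG h2
      simp

/-! ### The unique prefix that decides the state of a sequence -/

/-- After the first prefix on which `treeRuleStep` is not `ε`, the rule is `ε` by definition. This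
is the source of all the uniqueness statements for `IsIns` and `IsDel`. -/
theorem eq_of_treeRule_ne_idle {p p' x : List V} (h : treeRule G p ≠ .idle)
    (h' : treeRule G p' ≠ .idle) (hp : p <+: x) (hp' : p' <+: x) : p = p' := by
  have key : ∀ p p' : List V, treeRule G p ≠ .idle → treeRule G p' ≠ .idle → p <+: p' → p = p' := by
    intro p p' h h' hpp
    by_contra hne
    rw [treeRule] at h h'
    split_ifs at h h' with h1 h2
    · exact h (h2 p hpp hne)
    all_goals simp at h h'
  rcases List.prefix_or_prefix_of_prefix hp hp' with h1 | h1
  · exact key _ _ h h' h1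
  · exact (key _ _ h' h h1).symm

theorem IsIns.unique (hG : G.IsTree) {q q' s s' : List V} {c a b c' a' b' : V}
    (h : IsIns G q c a b) (h' : IsIns G q' c' a' b')
    (e : q ++ c :: b :: s = q' ++ c' :: b' :: s') :
    q = q' ∧ c = c' ∧ a = a' ∧ b = b' ∧ s = s' := by
  have h1 := (treeRule_eq_insert_iff hG).2 h
  have h1' := (treeRule_eq_insert_iff hG).2 h'
  have e1 := eq_of_treeRule_ne_idle (x := q ++ c :: b :: s) (by rw [h1]; simp) (by rw [h1']; simp)
    ⟨s, by simp⟩ ⟨s', by simp [e]⟩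
  obtain ⟨rfl, e2⟩ := List.append_inj' e1 rfl
  obtain ⟨rfl, rfl⟩ : c = c' ∧ b = b' := by simpa using e2
  rw [h1] at h1'
  exact ⟨rfl, rfl, RuleValue.insert.inj h1', rfl, by simpa using e⟩

theorem IsDel.unique (hG : G.IsTree) {q q' s s' : List V} {c a b c' a' b' : V}
    (h : IsDel G q c a b) (h' : IsDel G q' c' a' b')
    (e : q ++ c :: a :: b :: s = q' ++ c' :: a' :: b' :: s') :
    q = q' ∧ c = c' ∧ a = a' ∧ b = b' ∧ s = s' := by
  have h1 := (treeRule_eq_delete_iff hG).2 h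
  have h1' := (treeRule_eq_delete_iff hG).2 h'
  have e1 := eq_of_treeRule_ne_idle (x := q ++ c :: a :: b :: s) (by rw [h1]; simp)
    (by rw [h1']; simp) ⟨s, by simp⟩ ⟨s', by simp [e]⟩
  obtain ⟨rfl, e2⟩ := List.append_inj' e1 rfl
  obtain ⟨rfl, rfl, rfl⟩ : c = c' ∧ a = a' ∧ b = b' := by simpa using e2
  exact ⟨rfl, rfl, rfl, rfl, by simpa using e⟩

theorem IsIns.not_isDel (hG : G.IsTree) {q q' s s' : List V} {c a b c' a' b' : V}
    (h : IsIns G q c a b) (h' : IsDel G q' c' a' b')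
    (e : q ++ c :: b :: s = q' ++ c' :: a' :: b' :: s') : False := by
  have h1 := (treeRule_eq_insert_iff hG).2 h
  have h1' := (treeRule_eq_delete_iff hG).2 h'
  have e1 := eq_of_treeRule_ne_idle (x := q ++ c :: b :: s) (by rw [h1]; simp)
    (by rw [h1']; simp) ⟨s, by simp⟩ ⟨s', by simp [e]⟩
  rw [e1, h1'] at h1
  cases h1

theorem not_isIdle_of_treeRule_ne_idle {p x : List V} (h : treeRule G p ≠ .idle) (hp : p <+: x) :
    ¬ IsIdle G x := by
  intro h'
  rw [treeRule] at h
  split_ifs at h with h1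
  · exact h (h' p hp)
  · exact h rfl

theorem IsIns.not_isIdle (hG : G.IsTree) {q s : List V} {c a b : V} (h : IsIns G q c a b) :
    ¬ IsIdle G (q ++ c :: b :: s) :=
  not_isIdle_of_treeRule_ne_idle (p := q ++ [c, b])
    (by rw [(treeRule_eq_insert_iff hG).2 h]; simp) ⟨s, by simp⟩

theorem IsDel.not_isIdle (hG : G.IsTree) {q s : List V} {c a b : V} (h : IsDel G q c a b) :
    ¬ IsIdle G (q ++ c :: a :: b :: s) :=
  not_isIdle_of_treeRule_ne_idle (p := q ++ [c, a, b])
    (by rw [(treeRule_eq_delete_iff hG).2 h]; simp) ⟨s, by simp⟩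

theorem treeRule_eq_insert (hG : G.IsTree) {x : List V} {v : V} (h : treeRule G x = .insert v) :
    ∃ q c b, x = q ++ [c, b] ∧ IsIns G q c v b := by
  rcases List.eq_nil_or_concat x with rfl | ⟨x, b, rfl⟩
  · simp [treeRule, treeRuleStep_nil] at h
  rcases List.eq_nil_or_concat x with rfl | ⟨q, c, rfl⟩
  · simp [treeRule, treeRuleStep_singleton] at h
  have e : (q.concat c).concat b = q ++ [c, b] := by simp
  rw [e] at h ⊢
  exact ⟨q, c, b, rfl, (treeRule_eq_insert_iff hG).1 h⟩

theorem treeRule_eq_delete (hG : G.IsTree) {x : List V} (h : treeRule G x = .delete) :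
    ∃ q c a b, x = q ++ [c, a, b] ∧ IsDel G q c a b := by
  rcases List.eq_nil_or_concat x with rfl | ⟨x, b, rfl⟩
  · simp [treeRule, treeRuleStep_nil] at h
  rcases List.eq_nil_or_concat x with rfl | ⟨x, a, rfl⟩
  · simp [treeRule, treeRuleStep_singleton] at h
  rcases List.eq_nil_or_concat x with rfl | ⟨q, c, rfl⟩
  · exfalso
    rw [List.concat_nil, List.concat_eq_append, treeRule_append_singleton,
      List.singleton_append, treeRuleStep_pair] at h
    split_ifs at h
  have e : ((q.concat c).concat a).concat b = q ++ [c, a, b] := by simp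
  rw [e] at h ⊢
  exact ⟨q, c, a, b, rfl, (treeRule_eq_delete_iff hG).1 h⟩

/-- The three cases will be the states unmatched, insert and delete. The first prefix on which the
rule is not `ε` decides, and further entries change nothing. -/
theorem isIdle_or_isIns_or_isDel (hG : G.IsTree) (x : List V) :
    IsIdle G x ∨ (∃ q c a b s, IsIns G q c a b ∧ x = q ++ c :: b :: s) ∨
      ∃ q c a b s, IsDel G q c a b ∧ x = q ++ c :: a :: b :: s := by
  induction x using List.reverseRecOn with
  | nil => exact .inl isIdle_nil
  | append_singleton p d ih =>
    rcases ih with h | ⟨q, c, a, b, s, h, rfl⟩ | ⟨q, c, a, b, s, h, rfl⟩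
    · cases hs : treeRuleStep G (p ++ [d]) with
      | idle => exact .inl (isIdle_append_singleton.2 ⟨h, hs⟩)
      | insert v =>
        have hF : treeRule G (p ++ [d]) = .insert v := by
          rw [treeRule_append_singleton, if_pos h, hs]
        obtain ⟨q, c, b, e, hi⟩ := treeRule_eq_insert hG hF
        exact .inr (.inl ⟨q, c, v, b, [], hi, e⟩)
      | delete =>
        have hF : treeRule G (p ++ [d]) = .delete := by
          rw [treeRule_append_singleton, if_pos h, hs]
        obtain ⟨q, c, a, b, e, hi⟩ := treeRule_eq_delete hG hF
        exact .inr (.inr ⟨q, c, a, b, [], hi, e⟩)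
    · exact .inr (.inl ⟨q, c, a, b, s ++ [d], h, by simp⟩)
    · exact .inr (.inr ⟨q, c, a, b, s ++ [d], h, by simp⟩)

theorem isValidRule_treeRule (hG : G.IsTree) : IsValidRule G (treeRule G) where
  of_insert := by
    intro x v hx h
    obtain ⟨q, c, b, rfl, hi⟩ := treeRule_eq_insert hG h
    have hc : (q ++ [c]).IsChain (· ≠ ·) := ((isSeq_iff hG.connected).1 hx).2.prefix ⟨[b], by simp⟩
    have hd := (isDel_iff_isIns hG hc).2 hi
    refine ⟨q, c, b, rfl, ?_, hi.ne, hi.step.2.symm, ?_, (treeRule_eq_delete_iff hG).2 hd⟩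
    · rintro rfl
      simpa using hi.step.1
    · by_contra h'
      exact not_isIdle_of_treeRule_ne_idle h' List.prefix_rfl hd.idle
  of_delete := by
    intro x hx h
    obtain ⟨q, c, a, b, rfl, hd⟩ := treeRule_eq_delete hG h
    have hc : (q ++ [c]).IsChain (· ≠ ·) :=
      ((isSeq_iff hG.connected).1 hx).2.prefix ⟨[a, b], by simp⟩
    exact ⟨q, c, a, b, rfl, hd.step.2.symm,
      (treeRule_eq_insert_iff hG).2 ((isDel_iff_isIns hG hc).1 hd)⟩

/-! ### Prefix matchings are determined by the rule that generates them -/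

theorem Edge.isSeq_left {x y : List V} (h : Edge G x y) : IsSeq G x := by
  obtain ⟨k, l, i, hx, -⟩ := edge_iff.1 h
  exact ⟨_, _, hx⟩

theorem Edge.length_eq {x y : List V} (h : Edge G x y) : x.length = y.length + 1 := by
  obtain ⟨k, l, i, hx, hy, -⟩ := edge_iff.1 h
  rw [hx.1, hy.1]

theorem Edge.exists_eraseIdx {x y : List V} (h : Edge G x y) :
    ∃ i, i + 1 < x.length ∧ y = x.eraseIdx i := by
  obtain ⟨k, l, i, hx, hy, hi, e⟩ := edge_iff.1 h
  refine ⟨i, ?_, e⟩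
  rw [hx.1]
  rw [Finset.mem_Icc] at hi
  omega

theorem Edge.exists_insertIdx {x y : List V} (h : Edge G x y) :
    ∃ i v, i + 1 < y.length ∧ x = y.insertIdx (i + 1) v := by
  obtain ⟨k, l, i, hx, hy, hi, rfl⟩ := edge_iff.1 h
  rw [Finset.mem_Icc] at hi
  have hlt : i < x.length := by rw [hx.1]; omega
  refine ⟨i - 1, x[i], ?_, ?_⟩
  · rw [hy.1]; omega
  · rw [Nat.sub_add_cancel hi.1, List.insertIdx_eraseIdx_getElem hlt]

/-! ### States in matchings and prefix matchings -/

section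

variable {M : List V → List V → Prop}

theorem HasInsert.unique (hM : IsMatching G M) {x : List V} {i j : ℕ} {v w : V}
    (h : HasInsert M x i v) (h' : HasInsert M x j w) : i = j ∧ v = w := by
  have e := hM.source_unique _ _ _ h.2 h'.2
  obtain ⟨_, _, -, hc, -⟩ := (hM.edge _ _ h.2).isSeq_left
  have := insertIdx_injective_of_isChain hc h.1.le h'.1.le e
  exact ⟨by omega, this.2⟩

theorem HasDelete.unique (hM : IsMatching G M) {x : List V} {i j : ℕ}
    (h : HasDelete M x i) (h' : HasDelete M x j) : i = j := by
  have e := hM.target_unique _ _ _ h.2 h'.2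
  obtain ⟨_, _, -, hc, -⟩ := (hM.edge _ _ h.2).isSeq_left
  exact eraseIdx_injective_of_isChain hc h.1 h'.1 e

/-- The definition of the state allows the last position, but the differential omits interior
vertices only. -/
theorem HasDelete.lt (hM : IsMatching G M) {x : List V} {i : ℕ} (h : HasDelete M x i) :
    i + 1 < x.length := by
  obtain ⟨j, hj, e⟩ := (hM.edge _ _ h.2).exists_eraseIdx
  obtain ⟨_, _, -, hc, -⟩ := (hM.edge _ _ h.2).isSeq_left
  rwa [eraseIdx_injective_of_isChain hc h.1 (by omega) e]

theorem HasInsert.not_hasDelete (hM : IsMatching G M) {x : List V} {i j : ℕ} {v : V}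
    (h : HasInsert M x i v) (h' : HasDelete M x j) : False :=
  hM.source_target _ _ _ h.2 h'.2

theorem unmatched_iff (hM : IsMatching G M) {x : List V} :
    Unmatched M x ↔ (∀ i v, ¬ HasInsert M x i v) ∧ ∀ i, ¬ HasDelete M x i := by
  constructor
  · exact fun h => ⟨fun i v h' => (h _).2 h'.2, fun i h' => (h _).1 h'.2⟩
  · rintro ⟨h1, h2⟩ y
    constructor
    · intro h
      obtain ⟨i, hi, rfl⟩ := (hM.edge _ _ h).exists_eraseIdx
      exact h2 i ⟨by omega, h⟩
    · intro h
      obtain ⟨i, v, hi, rfl⟩ := (hM.edge _ _ h).exists_insertIdx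
      exact h1 i v ⟨hi, h⟩

theorem HasInsert.append (hM : IsPrefixMatching G M) {p : List V} {b : V} {i : ℕ} {v : V}
    (h : HasInsert M p i v) (hp : IsSeq G (p ++ [b])) : HasInsert M (p ++ [b]) i v :=
  hM.insert_of_prefix _ _ _ _ h hp ((List.take_prefix _ _).trans (List.prefix_append _ _))

theorem HasDelete.append (hM : IsPrefixMatching G M) {p : List V} {b : V} {i : ℕ}
    (h : HasDelete M p i) (hp : IsSeq G (p ++ [b])) : HasDelete M (p ++ [b]) i :=
  hM.delete_of_prefix _ _ _ h hp ((List.take_prefix _ _).trans (List.prefix_append _ _))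

theorem take_append_singleton_prefix {p : List V} {b : V} {n : ℕ} (h : n ≤ p.length) :
    (p ++ [b]).take n <+: p := by
  rw [List.take_append_of_le_length h]
  exact List.take_prefix _ _

theorem HasInsert.of_append (hM : IsPrefixMatching G M) {p : List V} {b : V} {i : ℕ} {v : V}
    (h : HasInsert M (p ++ [b]) i v) (hp : IsSeq G p) (hi : i + 1 < p.length) :
    HasInsert M p i v :=
  hM.insert_of_prefix _ _ _ _ h hp (take_append_singleton_prefix hi)

theorem HasDelete.of_append (hM : IsPrefixMatching G M) {p : List V} {b : V} {i : ℕ}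
    (h : HasDelete M (p ++ [b]) i) (hp : IsSeq G p) (hi : i + 1 < p.length) :
    HasDelete M p i :=
  hM.delete_of_prefix _ _ _ h hp (take_append_singleton_prefix hi)

/-- Any state of `p` would persist on `p ++ [b]`, at an earlier place or of the other kind, whereas
a sequence has only one state. -/
theorem HasInsert.unmatched (hM : IsPrefixMatching G M) {p : List V} {b v : V} {i : ℕ}
    (h : HasInsert M (p ++ [b]) i v) (hp : IsSeq G (p ++ [b])) (hi : p.length ≤ i + 1) :
    Unmatched M p := by
  refine (unmatched_iff hM.isMatching).2 ⟨fun j w h' => ?_, fun j h' => ?_⟩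
  · have := ((h'.append hM hp).unique hM.isMatching h).1
    have := h'.1
    omega
  · exact h.not_hasDelete hM.isMatching (h'.append hM hp)

theorem HasDelete.unmatched (hM : IsPrefixMatching G M) {p : List V} {b : V} {i : ℕ}
    (h : HasDelete M (p ++ [b]) i) (hp : IsSeq G (p ++ [b])) (hi : p.length ≤ i + 1) :
    Unmatched M p := by
  refine (unmatched_iff hM.isMatching).2 ⟨fun j w h' => ?_, fun j h' => ?_⟩
  · exact (h'.append hM hp).not_hasDelete hM.isMatching h
  · have := (h'.append hM hp).unique hM.isMatching h
    have := h'.lt hM.isMatching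
    omega

end

/-- A state of `p ++ [b]` before the last place is a state of `p`, to which induction applies. A
state at the last place forces `p` to be unmatched, and then `F` prescribes it. -/
theorem states_of_isGeneratedBy (hG : G.Connected) {F : List V → RuleValue V}
    {M N : List V → List V → Prop} (hM : IsPrefixMatching G M) (hMF : IsGeneratedBy G F M)
    (hN : IsPrefixMatching G N) (hNF : IsGeneratedBy G F N) (x : List V) (hx : IsSeq G x) :
    (∀ i v, HasInsert M x i v → HasInsert N x i v) ∧ ∀ i, HasDelete M x i → HasDelete N x i := by
  induction x using List.reverseRecOn generalizing M N with
  | nil => simp [isSeq_iff hG] at hx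
  | append_singleton p b ih =>
    rcases List.eq_nil_or_concat p with rfl | ⟨p', a, ha⟩
    · constructor
      · intro i v h
        simpa using h.1
      · intro i h
        simpa using h.lt hM.isMatching
    have hne : p ≠ [] := by rw [ha]; simp
    have hp : IsSeq G p := hx.of_prefix hG (List.prefix_append _ _) hne
    have hpos := List.length_pos_iff.2 hne
    obtain ⟨ih1, ih2⟩ := ih hM hMF hN hNF hp
    have ih3 : Unmatched M p → Unmatched N p := by
      intro h
      rw [unmatched_iff hM.isMatching] at h
      -- The induction is generalized over both matchings so that their roles can be exchanged here.
      obtain ⟨ih1', ih2'⟩ := ih hN hNF hM hMF hp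
      exact (unmatched_iff hN.isMatching).2
        ⟨fun i v h' => h.1 i v (ih1' i v h'), fun i h' => h.2 i (ih2' i h')⟩
    constructor
    · intro i v h
      have hi := h.1
      rw [List.length_append, List.length_singleton] at hi
      by_cases hlt : i + 1 < p.length
      · exact (ih1 i v (h.of_append hM hp hlt)).append hN hx
      · have hu := h.unmatched hM hx (by omega)
        obtain rfl : i = p.length - 1 := by omega
        exact ((hNF p b hne hx (ih3 hu)).1 v).2 (((hMF p b hne hx hu).1 v).1 h)
    · intro i h
      have hi := h.lt hM.isMatching
      rw [List.length_append, List.length_singleton] at hi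
      by_cases hlt : i + 1 < p.length
      · exact (ih2 i (h.of_append hM hp hlt)).append hN hx
      · have hu := h.unmatched hM hx (by omega)
        obtain rfl : i = p.length - 1 := by omega
        exact ((hNF p b hne hx (ih3 hu)).2).2 (((hMF p b hne hx hu).2).1 h)

/-- A rule generates at most one prefix matching. -/
theorem IsGeneratedBy.unique (hG : G.Connected) {F : List V → RuleValue V}
    {M N : List V → List V → Prop} (hM : IsPrefixMatching G M) (hMF : IsGeneratedBy G F M)
    (hN : IsPrefixMatching G N) (hNF : IsGeneratedBy G F N) : M = N := by
  have key : ∀ {M N : List V → List V → Prop}, IsPrefixMatching G M → IsGeneratedBy G F M →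
      IsPrefixMatching G N → IsGeneratedBy G F N → ∀ x y, M x y → N x y := by
    intro M N hM hMF hN hNF x y h
    have he := hM.isMatching.edge _ _ h
    obtain ⟨i, hi, rfl⟩ := he.exists_eraseIdx
    exact ((states_of_isGeneratedBy hG hM hMF hN hNF x he.isSeq_left).2 i ⟨by omega, h⟩).2
  exact funext fun x => funext fun y => propext
    ⟨key hM hMF hN hNF x y, key hN hNF hM hMF x y⟩

/-! ### The matching of a tree -/

/-- The prefix matching generated by the rule of a tree. -/
def treeMatching (G : SimpleGraph V) (x y : List V) : Prop :=
  IsSeq G x ∧ ∃ q c a b s, IsDel G q c a b ∧ x = q ++ c :: a :: b :: s ∧ y = q ++ c :: b :: s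

theorem eraseIdx_append_cons (q : List V) (c a : V) (s : List V) :
    (q ++ c :: a :: s).eraseIdx (q.length + 1) = q ++ c :: s := by
  rw [List.eraseIdx_append_of_length_le (by omega)]
  simp

theorem insertIdx_append_cons (q : List V) (c a : V) (s : List V) :
    (q ++ c :: s).insertIdx (q.length + 1) a = q ++ c :: a :: s := by
  induction q with
  | nil => simp
  | cons d q ih => simpa using ih

theorem isChain_of_append {q : List V} {c : V} {s : List V}
    (h : (q ++ c :: s).IsChain (· ≠ ·)) : (q ++ [c]).IsChain (· ≠ ·) :=
  (List.isChain_split.1 h).1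

theorem isSeq_insert_iff (hG : G.Connected) {q s : List V} {c a b : V} (h : IsFirstStep G c b a)
    (hab : a ≠ b) : IsSeq G (q ++ c :: a :: b :: s) ↔ IsSeq G (q ++ c :: b :: s) := by
  have hca : c ≠ a := by
    rintro rfl
    simpa using h.1
  rw [isSeq_iff hG, isSeq_iff hG, List.isChain_split, List.isChain_split (l₂ := b :: s)]
  simp [hca, hab, h.ne]

/-- The definition reads an edge from its longer end; this form reads it from the shorter end, as
needed for the uniqueness of the source. -/
theorem treeMatching_iff_isIns (hG : G.IsTree) {x y : List V} : treeMatching G x y ↔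
    IsSeq G y ∧ ∃ q c a b s, IsIns G q c a b ∧ x = q ++ c :: a :: b :: s ∧
      y = q ++ c :: b :: s := by
  constructor
  · rintro ⟨hx, q, c, a, b, s, h, rfl, rfl⟩
    have hc := isChain_of_append ((isSeq_iff hG.connected).1 hx).2
    exact ⟨(isSeq_insert_iff hG.connected h.step h.ne).1 hx, q, c, a, b, s,
      (isDel_iff_isIns hG hc).1 h, rfl, rfl⟩
  · rintro ⟨hy, q, c, a, b, s, h, rfl, rfl⟩
    have hc := isChain_of_append ((isSeq_iff hG.connected).1 hy).2
    exact ⟨(isSeq_insert_iff hG.connected h.step h.ne).2 hy, q, c, a, b, s,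
      (isDel_iff_isIns hG hc).2 h, rfl, rfl⟩

theorem isMatching_treeMatching (hG : G.IsTree) : IsMatching G (treeMatching G) where
  edge := by
    rintro _ _ ⟨hx, q, c, a, b, s, h, rfl, rfl⟩
    have hca : c ≠ a := by
      rintro rfl
      simpa using h.step.1
    obtain ⟨k, l, hi⟩ := hx
    obtain ⟨k, rfl⟩ : ∃ k', k = k' + 1 := ⟨k - 1, by have := hi.1; simp at this; omega⟩
    refine edge_iff.2 ⟨k, l, q.length + 1, hi,
      (isIndex_insert_iff hG.connected hca h.ne h.step.2.symm).1 hi, ?_,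
      (eraseIdx_append_cons _ _ _ _).symm⟩
    have := hi.1
    simp only [List.length_append, List.length_cons] at this
    rw [Finset.mem_Icc]
    omega
  target_unique := by
    rintro _ _ _ ⟨-, q, c, a, b, s, h, rfl, rfl⟩ ⟨-, q', c', a', b', s', h', e, rfl⟩
    obtain ⟨rfl, rfl, rfl, rfl, rfl⟩ := h.unique hG h' e
    rfl
  source_unique := by
    intro x x' y h h'
    rw [treeMatching_iff_isIns hG] at h h'
    obtain ⟨-, q, c, a, b, s, h, rfl, rfl⟩ := h
    obtain ⟨-, q', c', a', b', s', h', rfl, e⟩ := h'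
    obtain ⟨rfl, rfl, rfl, rfl, rfl⟩ := h.unique hG h' e
    rfl
  source_target := by
    intro x y z h h'
    rw [treeMatching_iff_isIns hG] at h
    obtain ⟨-, q, c, a, b, s, h, rfl, rfl⟩ := h
    obtain ⟨-, q', c', a', b', s', h', e, rfl⟩ := h'
    exact h.not_isDel hG h' e

theorem hasInsert_treeMatching_iff (hG : G.IsTree) {x : List V} {i : ℕ} {v : V} :
    HasInsert (treeMatching G) x i v ↔ IsSeq G x ∧ ∃ q c b s, IsIns G q c v b ∧
      x = q ++ c :: b :: s ∧ i = q.length := by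
  constructor
  · rintro ⟨hi, h⟩
    have hc := ((isSeq_iff hG.connected).1 h.1).2
    obtain ⟨hx, q, c, a, b, s, h, e, rfl⟩ := (treeMatching_iff_isIns hG).1 h
    rw [← insertIdx_append_cons q c a] at e
    obtain ⟨e1, rfl⟩ := insertIdx_injective_of_isChain hc hi.le (by simp) e
    exact ⟨hx, q, c, b, s, h, rfl, by omega⟩
  · rintro ⟨hx, q, c, b, s, h, rfl, rfl⟩
    refine ⟨by simp, (treeMatching_iff_isIns hG).2 ⟨hx, q, c, v, b, s, h, ?_, rfl⟩⟩
    rw [insertIdx_append_cons]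

theorem hasDelete_treeMatching_iff (hG : G.IsTree) {x : List V} {i : ℕ} :
    HasDelete (treeMatching G) x i ↔ IsSeq G x ∧ ∃ q c a b s, IsDel G q c a b ∧
      x = q ++ c :: a :: b :: s ∧ i = q.length + 1 := by
  constructor
  · rintro ⟨hi, h⟩
    have hc := ((isSeq_iff hG.connected).1 h.1).2
    obtain ⟨hx, q, c, a, b, s, h, rfl, e⟩ := h
    exact ⟨hx, q, c, a, b, s, h, rfl, eraseIdx_injective_of_isChain hc hi (by simp)
      (e.trans (eraseIdx_append_cons q c a _).symm)⟩
  · rintro ⟨hx, q, c, a, b, s, h, rfl, rfl⟩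
    refine ⟨by simp, hx, q, c, a, b, s, h, rfl, ?_⟩
    rw [eraseIdx_append_cons]

theorem isPrefixMatching_treeMatching (hG : G.IsTree) :
    IsPrefixMatching G (treeMatching G) where
  isMatching := isMatching_treeMatching hG
  insert_of_prefix := by
    intro x y i v h hy hp
    obtain ⟨-, q, c, b, s, h', rfl, rfl⟩ := (hasInsert_treeMatching_iff hG).1 h
    have e : (q ++ c :: b :: s).take (q.length + 2) = q ++ [c, b] := by
      rw [List.take_length_add_append]
      simp
    obtain ⟨t, rfl⟩ := e ▸ hp
    exact (hasInsert_treeMatching_iff hG).2 ⟨hy, q, c, b, t, h', by simp, rfl⟩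
  delete_of_prefix := by
    intro x y i h hy hp
    obtain ⟨-, q, c, a, b, s, h', rfl, rfl⟩ := (hasDelete_treeMatching_iff hG).1 h
    have e : (q ++ c :: a :: b :: s).take (q.length + 1 + 2) = q ++ [c, a, b] := by
      rw [add_assoc, List.take_length_add_append]
      simp
    obtain ⟨t, rfl⟩ := e ▸ hp
    exact (hasDelete_treeMatching_iff hG).2 ⟨hy, q, c, a, b, t, h', by simp, rfl⟩

theorem isGeneratedBy_treeMatching (hG : G.IsTree) :
    IsGeneratedBy G (treeRule G) (treeMatching G) := by
  intro p b hp hx _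
  have hpos := List.length_pos_iff.2 hp
  constructor
  · intro v
    rw [hasInsert_treeMatching_iff hG]
    constructor
    · rintro ⟨-, q, c, b', s, h, e, hl⟩
      have hlen := congrArg List.length e
      simp only [List.length_append, List.length_cons, List.length_nil] at hlen
      obtain rfl : s = [] := List.length_eq_zero_iff.1 (by omega)
      rw [e]
      exact (treeRule_eq_insert_iff hG).2 h
    · intro h
      obtain ⟨q, c, b', e, h⟩ := treeRule_eq_insert hG h
      have hlen := congrArg List.length e
      simp only [List.length_append, List.length_cons, List.length_nil] at hlen
      exact ⟨hx, q, c, b', [], h, e, by omega⟩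
  · rw [hasDelete_treeMatching_iff hG]
    constructor
    · rintro ⟨-, q, c, a, b', s, h, e, hl⟩
      have hlen := congrArg List.length e
      simp only [List.length_append, List.length_cons, List.length_nil] at hlen
      obtain rfl : s = [] := List.length_eq_zero_iff.1 (by omega)
      rw [e]
      exact (treeRule_eq_delete_iff hG).2 h
    · intro h
      obtain ⟨q, c, a, b', e, h⟩ := treeRule_eq_delete hG h
      have hlen := congrArg List.length e
      simp only [List.length_append, List.length_cons, List.length_nil] at hlen
      exact ⟨hx, q, c, a, b', [], h, e, by omega⟩

theorem eq_treeMatching (hG : G.IsTree) {M : List V → List V → Prop} (hM : IsPrefixMatching G M)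
    (h : IsGeneratedBy G (treeRule G) M) : M = treeMatching G :=
  IsGeneratedBy.unique hG.connected hM h (isPrefixMatching_treeMatching hG)
    (isGeneratedBy_treeMatching hG)

theorem unmatched_treeMatching_iff (hG : G.IsTree) {x : List V} (hx : IsSeq G x) :
    Unmatched (treeMatching G) x ↔ IsIdle G x := by
  constructor
  · intro h
    rcases isIdle_or_isIns_or_isDel hG x with h' | ⟨q, c, a, b, s, h', e⟩ | ⟨q, c, a, b, s, h', e⟩
    · exact h'
    · exact absurd ((treeMatching_iff_isIns hG).2 ⟨hx, q, c, a, b, s, h', rfl, e⟩) (h _).2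
    · exact absurd ⟨hx, q, c, a, b, s, h', e, rfl⟩ (h _).1
  · intro h y
    constructor
    · rintro ⟨-, q, c, a, b, s, h', rfl, -⟩
      exact h'.not_isIdle hG h
    · intro h'
      obtain ⟨-, q, c, a, b, s, hi, -, rfl⟩ := (treeMatching_iff_isIns hG).1 h'
      exact hi.not_isIdle hG h

theorem treeRule_append_singleton_of_isSeq (hG : G.IsTree) {p : List V} {b : V}
    (hx : IsSeq G (p ++ [b])) :
    (Unmatched (treeMatching G) p → treeRule G (p ++ [b]) = treeRuleStep G (p ++ [b])) ∧
      (¬ Unmatched (treeMatching G) p → treeRule G (p ++ [b]) = .idle) := by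
  have key : Unmatched (treeMatching G) p ↔ IsIdle G p := by
    -- The empty list is not a sequence; it lies on no edge and is idle, so it needs a separate
    -- argument.
    rcases eq_or_ne p [] with rfl | hp
    · refine iff_of_true (fun y => ⟨?_, ?_⟩) isIdle_nil
      · rintro ⟨-, q, c, a, b, s, -, h, -⟩
        simp at h
      · rintro ⟨-, q, c, a, b, s, -, -, h⟩
        simp at h
    · exact unmatched_treeMatching_iff hG
        (hx.of_prefix hG.connected (List.prefix_append _ _) hp)
  rw [key, treeRule_append_singleton]
  exact ⟨fun h => if_pos h, fun h => if_neg h⟩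

theorem isDiagonalRule_treeRule (hG : G.IsTree) : IsDiagonalRule G (treeRule G) := by
  refine ⟨isValidRule_treeRule hG, fun M hM hMF q a b hx hu hab => ?_⟩
  rw [eq_treeMatching hG hM hMF] at hu
  have e : q ++ [a, b] = (q ++ [a]) ++ [b] := by simp
  rw [e] at hx ⊢
  rw [(treeRule_append_singleton_of_isSeq hG hx).1 hu, ← e]
  rcases List.eq_nil_or_concat q with rfl | ⟨q, c, rfl⟩
  · rw [List.nil_append, treeRuleStep_pair, if_pos hab]
    simp
  · rw [List.concat_append, treeRuleStep_append, if_pos hab]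
    split_ifs <;> simp

/-! ### The unmatched sequences -/

theorem isIdle_append_back {q : List V} {c a : V} (h : IsIdle G (q ++ [c, a]))
    (hca : G.dist c a = 1) : IsIdle G (q ++ [c, a, c]) := by
  have e : q ++ [c, a, c] = (q ++ [c, a]) ++ [c] := by simp
  rw [e]
  refine isIdle_append_singleton.2 ⟨h, ?_⟩
  rw [← e, treeRuleStep_append, if_neg (by simp), if_neg]
  rw [SimpleGraph.dist_comm, hca]
  omega

/-- `alternating` grows at the front, while the rule reads the end of a sequence. -/
theorem alternating_succ_succ (u v : V) (k : ℕ) : ∃ q c a, alternating u v (k + 1) = q ++ [c, a] ∧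
    (c = u ∧ a = v ∨ c = v ∧ a = u) ∧ alternating u v (k + 2) = q ++ [c, a, c] := by
  induction k generalizing u v with
  | zero => exact ⟨[], u, v, rfl, .inl ⟨rfl, rfl⟩, rfl⟩
  | succ k ih =>
    obtain ⟨q, c, a, h1, h2, h3⟩ := ih v u
    exact ⟨u :: q, c, a, by rw [alternating, h1]; rfl, h2.symm, by rw [alternating, h3]; rfl⟩

theorem isIdle_alternating {u v : V} (h : G.Adj u v) (k : ℕ) :
    IsIdle G (alternating u v k) := by
  match k with
  | 0 => exact isIdle_singleton u
  | 1 =>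
    refine isIdle_append_singleton (p := [u]) (b := v).2 ⟨isIdle_singleton u, ?_⟩
    rw [List.singleton_append, treeRuleStep_pair, if_neg]
    rw [SimpleGraph.dist_eq_one_iff_adj.2 h]
    omega
  | k + 2 =>
    have ih := isIdle_alternating h (k + 1)
    obtain ⟨q, c, a, h1, h2, h3⟩ := alternating_succ_succ u v k
    rw [h3]
    rw [h1] at ih
    refine isIdle_append_back ih (SimpleGraph.dist_eq_one_iff_adj.2 ?_)
    rcases h2 with ⟨rfl, rfl⟩ | ⟨rfl, rfl⟩
    · exact h
    · exact h.symm

theorem isSeq_alternating (hG : G.Connected) {u v : V} (h : G.Adj u v) (k : ℕ) :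
    IsSeq G (alternating u v k) := by
  rw [isSeq_iff hG]
  induction k generalizing u v with
  | zero => simp [alternating]
  | succ k ih =>
    refine ⟨by simp [alternating], ?_⟩
    have := (ih h.symm).2
    rw [alternating]
    cases k with
    | zero => simpa [alternating] using h.ne
    | succ k =>
      rw [alternating] at this ⊢
      exact List.isChain_cons_cons.2 ⟨h.ne, this⟩

theorem eq_alternating_of_isIdle (hG : G.IsTree) {x : List V} (hx : IsSeq G x) (h : IsIdle G x) :
    (∃ v, x = [v]) ∨ ∃ u v k, G.Adj u v ∧ 1 ≤ k ∧ x = alternating u v k := by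
  induction x using List.reverseRecOn with
  | nil => simp [isSeq_iff hG.connected] at hx
  | append_singleton p b ih =>
    rcases eq_or_ne p [] with rfl | hne
    · exact .inl ⟨b, rfl⟩
    have hp : p <+: p ++ [b] := List.prefix_append _ _
    have hc := ((isSeq_iff hG.connected).1 hx).2
    right
    rcases ih (hx.of_prefix hG.connected hp hne) (h.of_prefix hp) with
      ⟨a, rfl⟩ | ⟨u, v, k, huv, hk, rfl⟩
    · have := h.dist_eq_one (q := []) hG.connected hc
      exact ⟨a, b, 1, SimpleGraph.dist_eq_one_iff_adj.1 this, le_rfl, rfl⟩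
    · obtain ⟨k, rfl⟩ : ∃ k', k = k' + 1 := ⟨k - 1, by omega⟩
      obtain ⟨q, c, a, h1, h2, h3⟩ := alternating_succ_succ u v k
      refine ⟨u, v, k + 2, huv, by omega, ?_⟩
      rw [h1, List.append_assoc, List.cons_append, List.cons_append, List.nil_append] at h hc ⊢
      rw [h3, h.last_eq hG hc]

theorem unmatched_eq (hG : G.IsTree) :
    {x : List V | IsSeq G x ∧ Unmatched (treeMatching G) x} =
      {x | ∃ v, x = [v]} ∪ {x | ∃ u v k, G.Adj u v ∧ 1 ≤ k ∧ x = alternating u v k} := by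
  ext x
  constructor
  · rintro ⟨hx, hu⟩
    exact eq_alternating_of_isIdle hG hx ((unmatched_treeMatching_iff hG hx).1 hu)
  · rintro (⟨v, rfl⟩ | ⟨u, v, k, huv, -, rfl⟩)
    · have hs : IsSeq G [v] := (isSeq_iff hG.connected).2 (by simp)
      exact ⟨hs, (unmatched_treeMatching_iff hG hs).2 (isIdle_singleton v)⟩
    · have hs := isSeq_alternating hG.connected huv k
      exact ⟨hs, (unmatched_treeMatching_iff hG hs).2 (isIdle_alternating huv k)⟩

/-! ### The faces of a sequence and its matching state -/

/-- An interior vertex of an idle prefix occurs as `c` in a turn `e, c, e`. Omitting it would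
shorten the sequence by `2 d(e, c) > 0`. -/
theorem not_isIndex_eraseIdx_of_isIdle (hG : G.IsTree) {k l i : ℕ} {x p : List V}
    (hx : IsIndex G (k + 1) l x) (hp : p <+: x) (h : IsIdle G p) (hi : 1 ≤ i)
    (hip : i + 1 < p.length) : ¬ IsIndex G k l (x.eraseIdx i) := by
  intro he
  obtain ⟨t, rfl⟩ := hp
  obtain ⟨i, rfl⟩ : ∃ j, i = j + 1 := ⟨i - 1, by omega⟩
  have e1 : p = p.take i ++ p[i] :: p[i + 1] :: p[i + 2] :: p.drop (i + 3) := by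
    rw [← List.drop_eq_getElem_cons, ← List.drop_eq_getElem_cons, ← List.drop_eq_getElem_cons,
      List.take_append_drop]
  have hl : (p.take i).length = i := by rw [List.length_take]; omega
  generalize p.take i = q at e1 hl
  generalize p[i] = e at e1
  generalize p[i + 1] = c at e1
  generalize p[i + 2] = f at e1
  generalize p.drop (i + 3) = s at e1
  subst e1 hl
  have e2 : q ++ e :: c :: f :: s ++ t = q ++ e :: c :: f :: (s ++ t) := by simp
  rw [e2] at he hx
  rw [eraseIdx_append_cons] at he
  have hpre : q ++ [e, c, f] <+: q ++ e :: c :: f :: s := ⟨s, by simp⟩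
  have hpre' : q ++ [e, c, f] <+: q ++ e :: c :: f :: (s ++ t) := ⟨s ++ t, by simp⟩
  have hbet := between_of_isIndex hG.connected hx he
  have hc := hx.2.1.prefix hpre'
  obtain rfl := (h.of_prefix hpre).last_eq hG hc
  have hfc : f ≠ c := by
    have := (List.isChain_split.1 hc).2
    simp at this
    exact this.1
  have := hG.connected.pos_dist_of_ne hfc
  rw [SimpleGraph.dist_self] at hbet
  omega

theorem IsDel.not_isIndex_eraseIdx (hG : G.IsTree) {k l i : ℕ} {q s : List V} {c a b : V}
    (h : IsDel G q c a b) (hx : IsIndex G (k + 1) l (q ++ c :: a :: b :: s)) (hi : 1 ≤ i)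
    (hiq : i ≤ q.length) : ¬ IsIndex G k l ((q ++ c :: a :: b :: s).eraseIdx i) :=
  not_isIndex_eraseIdx_of_isIdle hG hx ⟨b :: s, by simp⟩ h.idle hi
    (by rw [List.length_append, List.length_cons, List.length_singleton]; omega)

/-- Positions before `c` are interior to the idle prefix. Position `q.length` is `c` itself; if it
could be omitted, it would be the first step from its predecessor to `b`, against `last`. -/
theorem IsIns.not_isIndex_eraseIdx (hG : G.IsTree) {k l i : ℕ} {q s : List V} {c a b : V}
    (h : IsIns G q c a b) (hx : IsIndex G (k + 1) l (q ++ c :: b :: s)) (hi : 1 ≤ i)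
    (hiq : i ≤ q.length) : ¬ IsIndex G k l ((q ++ c :: b :: s).eraseIdx i) := by
  rcases hiq.lt_or_eq with hlt | rfl
  · exact not_isIndex_eraseIdx_of_isIdle hG hx ⟨b :: s, by simp⟩ h.idle hi
      (by rw [List.length_append, List.length_singleton]; omega)
  · rcases List.eq_nil_or_concat q with rfl | ⟨q, e, rfl⟩
    · simp at hi
    · intro he
      have e1 : q.concat e ++ c :: b :: s = q ++ e :: c :: b :: s := by simp
      have e2 : (q.concat e).length = q.length + 1 := by simp
      rw [e1, e2, eraseIdx_append_cons] at he
      rw [e1] at hx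
      have hid := h.idle
      rw [List.concat_append] at hid
      exact h.last q e (by simp)
        ⟨hid.dist_eq_one hG.connected (hx.2.1.prefix ⟨b :: s, by simp⟩),
          (between_of_isIndex hG.connected hx he).symm⟩

theorem IsFirstStep.left_ne {c a b : V} (h : IsFirstStep G c b a) : c ≠ a := by
  rintro rfl
  simpa using h.1

/-- The faces of `(q, c, b, s)` and of `(q, c, a, b, s)` at corresponding positions after `c`
are of the same form. -/
theorem IsDel.exists_eraseIdx (hG : G.IsTree) {k l i : ℕ} {q s : List V} {c a b : V}
    (h : IsDel G q c a b) (hx : IsIndex G (k + 1) l (q ++ c :: b :: s)) (hi : q.length + 1 ≤ i)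
    (hik : i ≤ k) : ∃ b' s', (q ++ c :: b :: s).eraseIdx i = q ++ c :: b' :: s' ∧
      (q ++ c :: a :: b :: s).eraseIdx (i + 1) = q ++ c :: a :: b' :: s' ∧
      (IsIndex G k l (q ++ c :: b' :: s') ↔ IsIndex G (k + 1) l (q ++ c :: a :: b' :: s')) ∧
      (IsIndex G k l (q ++ c :: b' :: s') → IsDel G q c a b') := by
  have hca := h.step.left_ne
  have hy := (isIndex_insert_iff hG.connected hca h.ne h.step.2.symm).2 hx
  have hlen := hx.1
  simp only [List.length_append, List.length_cons] at hlen
  -- Either `b` itself is omitted and its successor takes its place, or only `s` changes.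
  rcases hi.eq_or_lt with rfl | hlt
  · cases s with
    | nil =>
      simp only [List.length_nil] at hlen
      omega
    | cons b' s =>
      have hx' : IsIndex G k l (q ++ c :: b' :: s) → IsDel G q c a b' := by
        intro he
        have hbet := between_of_isIndex hG.connected hx he
        -- The new end `b'` is not `a`, because `d(c, b') ≥ d(c, b) ≥ 2`.
        refine ⟨h.idle, h.step.of_between hG.connected hbet, ?_⟩
        rintro rfl
        have := two_le_dist_of_isFirstStep hG.connected h.step h.ne
        have := h.step.1
        omega
      have e1 : q ++ c :: a :: b :: b' :: s = (q ++ [c]) ++ a :: b :: b' :: s := by simp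
      have e2 : q ++ c :: a :: b' :: s = (q ++ [c]) ++ a :: b' :: s := by simp
      refine ⟨b', s, eraseIdx_append_cons _ _ _ _, ?_, ⟨fun he => ?_, fun he => ?_⟩, hx'⟩
      · rw [e1, e2, show q.length + 1 + 1 = (q ++ [c]).length + 1 by simp, eraseIdx_append_cons]
      · have hd := hx' he
        obtain ⟨k, rfl⟩ : ∃ j, k = j + 1 := ⟨k - 1, by omega⟩
        exact (isIndex_insert_iff hG.connected hca hd.ne hd.step.2.symm).2 he
      · rw [e2] at he
        rw [e1] at hy
        have hbet := between_of_isIndex hG.connected hy he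
        have hab' : a ≠ b' := by
          rintro rfl
          have := hG.connected.pos_dist_of_ne h.ne
          rw [SimpleGraph.dist_self] at hbet
          omega
        rw [← e2] at he
        -- Here it is only known that `b` lies between `a` and `b'`; that `a` then lies between `c`
        -- and `b'` depends on the graph being a tree.
        have hs := h.step.glue hG h.ne hbet
        exact (isIndex_insert_iff hG.connected hca hab' hs.2.symm).1 he
  · obtain ⟨j, rfl⟩ : ∃ j, i = q.length + 2 + j := ⟨i - (q.length + 2), by omega⟩
    refine ⟨b, s.eraseIdx j, ?_, ?_, (isIndex_insert_iff hG.connected hca h.ne h.step.2.symm).symm,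
      fun _ => h⟩
    · rw [List.eraseIdx_append_of_length_le (by omega)]
      rw [show q.length + 2 + j - q.length = j + 2 by omega]
      simp
    · rw [List.eraseIdx_append_of_length_le (by omega)]
      rw [show q.length + 2 + j + 1 - q.length = j + 3 by omega]
      simp

/-- The faces of `(q, c, a, b, s)` except for `(q, c, b, s)` are again of the form
`(q, c, a, b', s')`. -/
theorem IsDel.exists_eraseIdx_of_isIndex (hG : G.IsTree) {k l i : ℕ} {q s : List V} {c a b : V}
    (h : IsDel G q c a b) (hx : IsIndex G (k + 1) l (q ++ c :: a :: b :: s)) (hi : 1 ≤ i)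
    (hik : i ≤ k) (hiq : i ≠ q.length + 1)
    (he : IsIndex G k l ((q ++ c :: a :: b :: s).eraseIdx i)) :
    ∃ b' s', IsDel G q c a b' ∧
      (q ++ c :: a :: b :: s).eraseIdx i = q ++ c :: a :: b' :: s' := by
  have hle : q.length < i := by
    by_contra hle
    exact h.not_isIndex_eraseIdx hG hx hi (by omega) he
  obtain ⟨k, rfl⟩ : ∃ j, k = j + 1 := ⟨k - 1, by omega⟩
  obtain ⟨i, rfl⟩ : ∃ j, i = j + 1 := ⟨i - 1, by omega⟩
  have hx' := (isIndex_insert_iff hG.connected h.step.left_ne h.ne h.step.2.symm).1 hx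
  obtain ⟨b', s', -, h2, h3, h4⟩ := h.exists_eraseIdx hG hx' (i := i) (by omega) (by omega)
  rw [h2] at he ⊢
  exact ⟨b', s', h4 (h3.2 he), rfl⟩

/-! ### The matching is a Morse matching -/

/-- The sequence is matched to a shorter one. -/
def IsDelType (G : SimpleGraph V) (x : List V) : Prop :=
  ∃ q c a b s, IsDel G q c a b ∧ x = q ++ c :: a :: b :: s

open scoped Classical in
/-- A function that decreases along the graph with the edges of the matching reversed. -/
noncomputable def morseHeight (G : SimpleGraph V) (x : List V) : ℕ :=
  -- A reversed edge of the matching adds one entry but enters deletion type, so the offset 2 gives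
  -- a net loss of 1. Any other edge loses one entry and never leaves deletion type.
  x.length + if IsDelType G x then 0 else 2

theorem morseHeight_lt (hG : G.IsTree) {x y : List V}
    (h : (Edge G x y ∧ ¬ treeMatching G x y) ∨ treeMatching G y x) :
    morseHeight G y < morseHeight G x := by
  rcases h with ⟨he, hM⟩ | hM
  · have hlen := he.length_eq
    have key : IsDelType G x → IsDelType G y := by
      rintro ⟨q, c, a, b, s, h, rfl⟩
      have hs := he.isSeq_left
      obtain ⟨k, l, i, hx, hy, hi, rfl⟩ := edge_iff.1 he
      rw [Finset.mem_Icc] at hi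
      have hiq : i ≠ q.length + 1 := by
        rintro rfl
        exact hM ⟨hs, q, c, a, b, s, h, rfl, eraseIdx_append_cons _ _ _ _⟩
      obtain ⟨b', s', h', e⟩ := h.exists_eraseIdx_of_isIndex hG hx hi.1 hi.2 hiq hy
      exact ⟨q, c, a, b', s', h', e⟩
    unfold morseHeight
    split_ifs with h1 h2
    · omega
    · omega
    · exact absurd (key ‹_›) h1
    · omega
  · have hlen := ((isMatching_treeMatching hG).edge _ _ hM).length_eq
    have hy : IsDelType G y := by
      obtain ⟨-, q, c, a, b, s, h, rfl, -⟩ := hM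
      exact ⟨q, c, a, b, s, h, rfl⟩
    have hx : ¬ IsDelType G x := by
      obtain ⟨-, q, c, a, b, s, h, -, rfl⟩ := (treeMatching_iff_isIns hG).1 hM
      rintro ⟨q', c', a', b', s', h', e⟩
      exact h.not_isDel hG h' e
    rw [morseHeight, morseHeight, if_pos hy, if_neg hx]
    omega

theorem isMorseMatching_treeMatching (hG : G.IsTree) : IsMorseMatching G (treeMatching G) := by
  refine ⟨isMatching_treeMatching hG, fun x h => ?_⟩
  have key : ∀ y, Relation.TransGen (fun a b => (Edge G a b ∧ ¬ treeMatching G a b) ∨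
      treeMatching G b a) x y → morseHeight G y < morseHeight G x := by
    intro y hy
    induction hy with
    | single h => exact morseHeight_lt hG h
    | tail _ h ih => exact (morseHeight_lt hG h).trans ih
  exact lt_irrefl _ (key x h)

/-! ### The contracting homotopy -/

open scoped Classical in
/-- The sequence with a vertex inserted according to the matching, with a sign, or `0` if the
sequence does not have an insertion state. -/
noncomputable def insertion (G : SimpleGraph V) (k l : ℕ) (x : List V) : MC G k l :=
  -- The number in `r` is the position of the inserted vertex, which determines the sign. In a tree,
  -- `IsIns.unique` makes the choice of `r` unique.
  if h : ∃ r : ℕ × List V, ∃ q c a b s, IsIns G q c a b ∧ x = q ++ c :: b :: s ∧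
      r = (q.length + 1, q ++ c :: a :: b :: s) then
    (-1 : ℤ) ^ h.choose.1 • gen G k l h.choose.2
  else 0

theorem insertion_of_isIns (hG : G.IsTree) {k l : ℕ} {q s : List V} {c a b : V}
    (h : IsIns G q c a b) : insertion G k l (q ++ c :: b :: s) =
      (-1 : ℤ) ^ (q.length + 1) • gen G k l (q ++ c :: a :: b :: s) := by
  have hex : ∃ r : ℕ × List V, ∃ q' c' a' b' s', IsIns G q' c' a' b' ∧
      q ++ c :: b :: s = q' ++ c' :: b' :: s' ∧
        r = (q'.length + 1, q' ++ c' :: a' :: b' :: s') := ⟨_, q, c, a, b, s, h, rfl, rfl⟩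
  rw [insertion, dif_pos hex]
  obtain ⟨q', c', a', b', s', h', e, e'⟩ := hex.choose_spec
  rw [e']
  obtain ⟨rfl, rfl, rfl, rfl, rfl⟩ := h.unique hG h' e
  rfl

theorem insertion_of_isDel (hG : G.IsTree) {k l : ℕ} {q s : List V} {c a b : V}
    (h : IsDel G q c a b) : insertion G k l (q ++ c :: a :: b :: s) = 0 := by
  rw [insertion, dif_neg]
  rintro ⟨r, q', c', a', b', s', h', e, -⟩
  exact h'.not_isDel hG h e.symm

theorem insertion_of_isIdle (hG : G.IsTree) {k l : ℕ} {x : List V} (h : IsIdle G x) :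
    insertion G k l x = 0 := by
  rw [insertion, dif_neg]
  rintro ⟨r, q', c', a', b', s', h', rfl, -⟩
  exact h'.not_isIdle hG h

/-- The homotopy that contracts the magnitude complex to the span of the unmatched sequences. -/
noncomputable def homotopy (G : SimpleGraph V) (k l : ℕ) : MC G k l →ₗ[ℤ] MC G (k + 1) l :=
  Finsupp.linearCombination ℤ fun x : Idx G k l => insertion G (k + 1) l x.1

theorem homotopy_gen {k l : ℕ} {x : List V} (hx : IsIndex G k l x) :
    homotopy G k l (gen G k l x) = insertion G (k + 1) l x := by
  simp [gen, homotopy, hx]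

theorem gen_eq_zero {k l : ℕ} {x : List V} (hx : ¬ IsIndex G k l x) : gen G k l x = 0 := by
  simp [gen, hx]

theorem sum_Icc_eq_of_eq_zero {A : Type*} [AddCommMonoid A] {f : ℕ → A} {m n : ℕ}
    (h : ∀ i, 1 ≤ i → i ≤ m → f i = 0) :
    ∑ i ∈ Finset.Icc 1 n, f i = ∑ i ∈ Finset.Icc (m + 1) n, f i := by
  refine (Finset.sum_subset (Finset.Icc_subset_Icc_left (by omega)) fun i hi hi' => ?_).symm
  rw [Finset.mem_Icc] at hi hi'
  exact h i hi.1 (by omega)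

theorem sum_Icc_succ_eq {A : Type*} [AddCommMonoid A] (f : ℕ → A) {m n : ℕ} (h : m ≤ n) :
    ∑ i ∈ Finset.Icc m (n + 1), f i = f m + ∑ i ∈ Finset.Icc m n, f (i + 1) := by
  rw [← Finset.Ico_add_one_right_eq_Icc, ← Finset.Ico_add_one_right_eq_Icc,
    Finset.sum_eq_sum_Ico_succ_bot (by omega), Finset.sum_Ico_add' f]

/-- Omitting the inserted `a` gives the sequence back. Face `i + 1` of the longer sequence is face
`i` of the shorter one with `a` inserted, and these terms cancel by the shift of the sign. Positions
up to `q.length` contribute nothing. -/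
theorem homotopy_gen_of_isIns (hG : G.IsTree) {k l : ℕ} {q s : List V} {c a b : V}
    (h : IsIns G q c a b) (hx : IsIndex G (k + 1) l (q ++ c :: b :: s)) :
    boundary G (k + 1) l (homotopy G (k + 1) l (gen G (k + 1) l (q ++ c :: b :: s))) +
      homotopy G k l (boundary G k l (gen G (k + 1) l (q ++ c :: b :: s))) =
        gen G (k + 1) l (q ++ c :: b :: s) := by
  have hd := (isDel_iff_isIns hG (isChain_of_append hx.2.1)).2 h
  have hy := (isIndex_insert_iff hG.connected h.step.left_ne h.ne h.step.2.symm).2 hx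
  have hlen := hx.1
  simp only [List.length_append, List.length_cons] at hlen
  rw [homotopy_gen hx, insertion_of_isIns hG h, map_smul, boundary_gen G hy, boundary_gen G hx,
    map_sum,
    sum_Icc_eq_of_eq_zero (m := q.length) (fun i hi hiq => by
      rw [gen_eq_zero (hd.not_isIndex_eraseIdx hG hy hi hiq), smul_zero]),
    sum_Icc_eq_of_eq_zero (m := q.length) (fun i hi hiq => by
      rw [gen_eq_zero (h.not_isIndex_eraseIdx hG hx hi hiq), smul_zero, map_zero])]
  -- If `b` is the last entry, the shorter sequence has no interior vertex after `c`, and only the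
  -- omission of `a` remains.
  rcases Nat.lt_or_ge k (q.length + 1) with hk | hk
  · obtain rfl : k = q.length := by omega
    rw [Finset.Icc_self, Finset.sum_singleton, Finset.Icc_eq_empty (by omega), Finset.sum_empty,
      eraseIdx_append_cons, smul_smul, ← mul_pow]
    simp
  rw [sum_Icc_succ_eq _ hk, smul_add, eraseIdx_append_cons, smul_smul, ← mul_pow, add_assoc,
    Finset.smul_sum, ← Finset.sum_add_distrib, Finset.sum_eq_zero]
  · simp
  · intro i hi
    rw [Finset.mem_Icc] at hi
    obtain ⟨b', s', e1, e2, e3, e4⟩ := hd.exists_eraseIdx hG hx hi.1 hi.2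
    rw [e1, e2, map_smul]
    by_cases hx' : IsIndex G k l (q ++ c :: b' :: s')
    · have hi' := (isDel_iff_isIns hG (isChain_of_append hx'.2.1)).1 (e4 hx')
      rw [homotopy_gen hx', insertion_of_isIns hG hi', smul_smul, smul_smul, ← add_smul]
      rw [pow_succ (-1 : ℤ) i, mul_comm ((-1 : ℤ) ^ i) ((-1) ^ (q.length + 1))]
      simp
    · rw [gen_eq_zero hx', gen_eq_zero (fun hy' => hx' (e3.2 hy'))]
      simp

/-- The homotopy kills sequences of deletion type, and all nonzero faces except the matched one are
again of this type. Inserting `a` into the matched face restores the sequence, with the square of a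
sign. -/
theorem homotopy_gen_of_isDel (hG : G.IsTree) {k l : ℕ} {q s : List V} {c a b : V}
    (h : IsDel G q c a b) (hx : IsIndex G (k + 1) l (q ++ c :: a :: b :: s)) :
    boundary G (k + 1) l (homotopy G (k + 1) l (gen G (k + 1) l (q ++ c :: a :: b :: s))) +
      homotopy G k l (boundary G k l (gen G (k + 1) l (q ++ c :: a :: b :: s))) =
        gen G (k + 1) l (q ++ c :: a :: b :: s) := by
  have hi := (isDel_iff_isIns hG (isChain_of_append hx.2.1)).1 h
  have hy := (isIndex_insert_iff hG.connected h.step.left_ne h.ne h.step.2.symm).1 hx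
  have hlen := hx.1
  simp only [List.length_append, List.length_cons] at hlen
  rw [homotopy_gen hx, insertion_of_isDel hG h, map_zero, zero_add, boundary_gen G hx, map_sum,
    Finset.sum_eq_single (q.length + 1)]
  · rw [eraseIdx_append_cons, map_smul, homotopy_gen hy, insertion_of_isIns hG hi, smul_smul,
      ← mul_pow]
    simp
  · intro i hik hiq
    rw [Finset.mem_Icc] at hik
    by_cases he : IsIndex G k l ((q ++ c :: a :: b :: s).eraseIdx i)
    · obtain ⟨b', s', h', e⟩ := h.exists_eraseIdx_of_isIndex hG hx hik.1 hik.2 hiq he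
      rw [map_smul, homotopy_gen he, e, insertion_of_isDel hG h', smul_zero]
    · rw [gen_eq_zero he, smul_zero, map_zero]
  · intro hq
    exact absurd (Finset.mem_Icc.2 ⟨by omega, by omega⟩) hq

theorem boundary_gen_of_isIdle (hG : G.IsTree) {k l : ℕ} {x : List V} (h : IsIdle G x)
    (hx : IsIndex G (k + 1) l x) : boundary G k l (gen G (k + 1) l x) = 0 := by
  rw [boundary_gen G hx]
  refine Finset.sum_eq_zero fun i hi => ?_
  rw [Finset.mem_Icc] at hi
  rw [gen_eq_zero, smul_zero]
  exact not_isIndex_eraseIdx_of_isIdle hG hx List.prefix_rfl h hi.1 (by rw [hx.1]; omega)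

/-! ### The homology -/

section

variable {k l : ℕ} (P : Idx G k l → Prop)

/-- The inclusion of the span of the sequences that satisfy `P`. -/
noncomputable def spanInclusion : ({x // P x} →₀ ℤ) →ₗ[ℤ] MC G k l :=
  Finsupp.lmapDomain ℤ ℤ Subtype.val

/-- The projection to the span of the sequences that satisfy `P`. -/
noncomputable def spanProjection : MC G k l →ₗ[ℤ] ({x // P x} →₀ ℤ) :=
  Finsupp.lcomapDomain Subtype.val Subtype.val_injective

theorem spanInclusion_single (x : {x // P x}) (n : ℤ) :
    spanInclusion P (Finsupp.single x n) = Finsupp.single x.1 n := by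
  simp [spanInclusion]

theorem spanProjection_inclusion (c : {x // P x} →₀ ℤ) :
    spanProjection P (spanInclusion P c) = c :=
  Finsupp.comapDomain_mapDomain _ Subtype.val_injective c

theorem spanInclusion_projection_single (x : Idx G k l) (h : P x) :
    spanInclusion P (spanProjection P (Finsupp.single x 1)) = Finsupp.single x 1 := by
  rw [← spanInclusion_single P ⟨x, h⟩, spanProjection_inclusion]

theorem spanInclusion_projection_single_of_not (x : Idx G k l) (h : ¬ P x) :
    spanInclusion P (spanProjection P (Finsupp.single x 1)) = 0 := by
  have : spanProjection P (Finsupp.single x 1) = 0 := by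
    ext y
    have hne : x ≠ y.1 := fun e => h (e ▸ y.2)
    simp [spanProjection, Finsupp.comapDomain_apply, hne]
  rw [this, map_zero]

end

/-! ### Cycles, boundaries and homology classes in terms of elements -/

theorem magnitudeComplex_d (k l : ℕ) (c : MC G (k + 1) l) :
    (magnitudeComplex G l).d (k + 1) k c = boundary G k l c :=
  ConcreteCategory.congr_hom (ChainComplex.of_d (fun k => ModuleCat.of ℤ (MC G k l))
    (fun k => ModuleCat.ofHom (boundary G k l)) k) c

theorem homologyπ_toCycles (k l : ℕ) (w : MC G (k + 1) l) :
    (magnitudeComplex G l).homologyπ k ((magnitudeComplex G l).toCycles (k + 1) k w) = 0 :=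
  ConcreteCategory.congr_hom ((magnitudeComplex G l).toCycles_comp_homologyπ (k + 1) k) w

theorem exists_toCycles_eq (k l : ℕ) (z : (magnitudeComplex G l).cycles k)
    (h : (magnitudeComplex G l).homologyπ k z = 0) :
    ∃ w : MC G (k + 1) l, (magnitudeComplex G l).toCycles (k + 1) k w = z := by
  have hex := ShortComplex.exact_of_g_is_cokernel (ShortComplex.mk _ _
      ((magnitudeComplex G l).toCycles_comp_homologyπ (k + 1) k))
    ((magnitudeComplex G l).homologyIsCokernel (k + 1) k (by simp))
  exact (ShortComplex.moduleCat_exact_iff _).1 hex z h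

theorem iCycles_toCycles (k l : ℕ) (w : MC G (k + 1) l) :
    (magnitudeComplex G l).iCycles k ((magnitudeComplex G l).toCycles (k + 1) k w) =
      boundary G k l w :=
  (ConcreteCategory.congr_hom ((magnitudeComplex G l).toCycles_i (k + 1) k) w).trans
    (magnitudeComplex_d k l w)

theorem iCycles_injective (k l : ℕ) :
    Function.Injective ((magnitudeComplex G l).iCycles k) :=
  (ModuleCat.mono_iff_injective _).1 inferInstance

theorem homologyπ_surjective (k l : ℕ) :
    Function.Surjective ((magnitudeComplex G l).homologyπ k) :=
  (ModuleCat.epi_iff_surjective _).1 inferInstance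

theorem d_iCycles (k j l : ℕ) (z : (magnitudeComplex G l).cycles k) :
    (magnitudeComplex G l).d k j ((magnitudeComplex G l).iCycles k z) = 0 := by
  rw [← ModuleCat.comp_apply, HomologicalComplex.iCycles_d]
  rfl

/-- If a projection to the span of some sequences, all of which are cycles, is homotopic to the
identity on the cycles and vanishes on the boundaries, then the homology classes of these sequences
form a basis. -/
theorem exists_basis {k l : ℕ} (P : Idx G k l → Prop)
    (h : MC G k l →ₗ[ℤ] MC G (k + 1) l)
    (hcyc : ∀ j x, P x → (magnitudeComplex G l).d k j (Finsupp.single x (1 : ℤ) : MC G k l) = 0)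
    (hhom : ∀ z : MC G k l, (∀ j, (magnitudeComplex G l).d k j z = 0) →
      boundary G k l (h z) + spanInclusion P (spanProjection P z) = z)
    (hb : ∀ w, spanProjection P (boundary G k l w) = 0) :
    ∃ B : Module.Basis {x // P x} ℤ (MH G k l),
      ∀ x, IsHomologyClass G (Finsupp.single x.1 1) (B x) := by
  let K := magnitudeComplex G l
  let f : ModuleCat.of ℤ ({x // P x} →₀ ℤ) ⟶ K.X k := ModuleCat.ofHom (spanInclusion P)
  have hf : f ≫ K.d k ((ComplexShape.down ℕ).next k) = 0 := by
    refine ModuleCat.hom_ext (Finsupp.lhom_ext' fun x => LinearMap.ext_ring ?_)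
    have := hcyc ((ComplexShape.down ℕ).next k) x.1 x.2
    rw [← spanInclusion_single P x] at this
    exact this
  let g : ModuleCat.of ℤ ({x // P x} →₀ ℤ) ⟶ K.cycles k := K.liftCycles f _ rfl hf
  have hg : ∀ c, K.iCycles k (g c) = spanInclusion P c := by
    intro c
    rw [← ModuleCat.comp_apply, HomologicalComplex.liftCycles_i]
    rfl
  let φ : ({x // P x} →₀ ℤ) →ₗ[ℤ] MH G k l := (g ≫ K.homologyπ k).hom
  have hφ : ∀ c, φ c = K.homologyπ k (g c) := fun c => rfl
  -- If the cycle given by `c` is a boundary, its projection is zero by `hb`, but this projection is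
  -- `c`.
  have hinj : Function.Injective φ := by
    rw [injective_iff_map_eq_zero]
    intro c hc
    obtain ⟨w, hw⟩ := exists_toCycles_eq k l (g c) hc
    have h1 : boundary G k l w = spanInclusion P c := by
      rw [← iCycles_toCycles, hw]
      exact hg c
    rw [← spanProjection_inclusion P c, ← h1, hb]
  have hsurj : Function.Surjective φ := by
    intro y
    obtain ⟨z, rfl⟩ := homologyπ_surjective k l y
    refine ⟨spanProjection P (K.iCycles k z), ?_⟩
    -- A cycle differs from its projection by the boundary of its image under `h`.
    have h1 : z = K.toCycles (k + 1) k (h (K.iCycles k z)) +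
        g (spanProjection P (K.iCycles k z)) := by
      apply iCycles_injective k l
      rw [map_add, hg]
      refine Eq.trans ?_ (congrArg (fun y : MC G k l => y + spanInclusion P _)
        (iCycles_toCycles k l (h (K.iCycles k z))).symm)
      exact (hhom _ fun j => d_iCycles k j l z).symm
    rw [hφ]
    conv_rhs => rw [h1]
    rw [map_add]
    refine Eq.trans ?_ (congrArg (· + _) (homologyπ_toCycles k l _).symm)
    exact (zero_add _).symm
  refine ⟨.ofRepr (LinearEquiv.ofBijective φ ⟨hinj, hsurj⟩).symm, fun x => ?_⟩
  refine ⟨g (Finsupp.single x 1), ?_, ?_⟩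
  · exact (hg _).trans (spanInclusion_single P x 1)
  · rfl

/-- The unmatched generators of `MC_{k,l}(G)`. -/
abbrev IsCritical (G : SimpleGraph V) (k l : ℕ) (x : Idx G k l) : Prop :=
  Unmatched (treeMatching G) x.1

theorem isCritical_iff (hG : G.IsTree) {k l : ℕ} (x : Idx G k l) :
    IsCritical G k l x ↔ IsIdle G x.1 :=
  unmatched_treeMatching_iff hG ⟨k, l, x.2⟩

theorem single_eq_gen {k l : ℕ} (x : Idx G k l) :
    (Finsupp.single x 1 : MC G k l) = gen G k l x.1 := by
  simp [gen, x.2]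

theorem homotopy_succ (hG : G.IsTree) (k l : ℕ) (z : MC G (k + 1) l) :
    boundary G (k + 1) l (homotopy G (k + 1) l z) + homotopy G k l (boundary G k l z) +
      spanInclusion (IsCritical G (k + 1) l) (spanProjection (IsCritical G (k + 1) l) z) = z := by
  suffices boundary G (k + 1) l ∘ₗ homotopy G (k + 1) l + homotopy G k l ∘ₗ boundary G k l +
      spanInclusion (IsCritical G (k + 1) l) ∘ₗ spanProjection (IsCritical G (k + 1) l) =
        LinearMap.id from LinearMap.congr_fun this z
  refine Finsupp.lhom_ext' fun x => LinearMap.ext_ring ?_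
  simp only [LinearMap.comp_apply, LinearMap.add_apply, Finsupp.lsingle_apply, LinearMap.id_apply]
  by_cases hc : IsCritical G (k + 1) l x
  · rw [spanInclusion_projection_single _ x hc]
    rw [isCritical_iff hG] at hc
    rw [single_eq_gen, boundary_gen_of_isIdle hG hc x.2, homotopy_gen x.2,
      insertion_of_isIdle hG hc, map_zero, map_zero, zero_add, zero_add]
  · rw [spanInclusion_projection_single_of_not _ x hc, add_zero]
    rw [isCritical_iff hG] at hc
    rw [single_eq_gen]
    obtain ⟨x, hx⟩ := x
    rcases (isIdle_or_isIns_or_isDel hG x).resolve_left hc with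
      ⟨q, c, a, b, s, h, rfl⟩ | ⟨q, c, a, b, s, h, rfl⟩
    · exact homotopy_gen_of_isIns hG h hx
    · exact homotopy_gen_of_isDel hG h hx

/-- In degree 0 there is no term `h∂`. All generators are single vertices, hence idle, and the
homotopy vanishes on them. -/
theorem homotopy_zero (hG : G.IsTree) (l : ℕ) (z : MC G 0 l) :
    boundary G 0 l (homotopy G 0 l z) +
      spanInclusion (IsCritical G 0 l) (spanProjection (IsCritical G 0 l) z) = z := by
  suffices boundary G 0 l ∘ₗ homotopy G 0 l +
      spanInclusion (IsCritical G 0 l) ∘ₗ spanProjection (IsCritical G 0 l) =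
        LinearMap.id from LinearMap.congr_fun this z
  refine Finsupp.lhom_ext' fun x => LinearMap.ext_ring ?_
  simp only [LinearMap.comp_apply, LinearMap.add_apply, Finsupp.lsingle_apply, LinearMap.id_apply]
  have hi : IsIdle G x.1 := by
    obtain ⟨a, ha⟩ := List.length_eq_one_iff.1 x.2.1
    rw [ha]
    exact isIdle_singleton a
  rw [spanInclusion_projection_single _ x ((isCritical_iff hG x).2 hi), single_eq_gen,
    homotopy_gen x.2, insertion_of_isIdle hG hi, map_zero, zero_add]

theorem boundary_boundary (k l : ℕ) (w : MC G (k + 2) l) :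
    boundary G k l (boundary G (k + 1) l w) = 0 :=
  LinearMap.congr_fun (boundary_comp_boundary G k l) w

theorem boundary_spanInclusion (hG : G.IsTree) (k l : ℕ)
    (c : {x // IsCritical G (k + 1) l x} →₀ ℤ) :
    boundary G k l (spanInclusion (IsCritical G (k + 1) l) c) = 0 := by
  suffices boundary G k l ∘ₗ spanInclusion (IsCritical G (k + 1) l) = 0 from
    LinearMap.congr_fun this c
  refine Finsupp.lhom_ext' fun x => LinearMap.ext_ring ?_
  simp only [LinearMap.comp_apply, Finsupp.lsingle_apply, LinearMap.zero_apply]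
  rw [spanInclusion_single, single_eq_gen]
  exact boundary_gen_of_isIdle hG ((isCritical_iff hG x.1).1 x.2) x.1.2

theorem homotopy_of_cycle (hG : G.IsTree) (k l : ℕ) (z : MC G k l)
    (hz : ∀ j, (magnitudeComplex G l).d k j z = 0) : boundary G k l (homotopy G k l z) +
      spanInclusion (IsCritical G k l) (spanProjection (IsCritical G k l) z) = z := by
  cases k with
  | zero => exact homotopy_zero hG l z
  | succ k =>
    have hz' : boundary G k l z = 0 := (magnitudeComplex_d k l z).symm.trans (hz k)
    have := homotopy_succ hG k l z
    rwa [hz', map_zero, add_zero] at this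

theorem d_boundary (k j l : ℕ) (w : MC G (k + 1) l) :
    (magnitudeComplex G l).d k j (boundary G k l w) = 0 := by
  rw [← iCycles_toCycles]
  exact d_iCycles k j l _

/-- Applying `∂` to `∂h + h∂ + π = 1` gives `∂h∂ = ∂`, since `∂∂ = 0` and `∂π = 0`. On the cycle
`∂w` the homotopy formula reads `∂h∂w + π∂w = ∂w`, so `π∂w = 0`. -/
theorem spanProjection_boundary (hG : G.IsTree) (k l : ℕ) (w : MC G (k + 1) l) :
    spanProjection (IsCritical G k l) (boundary G k l w) = 0 := by
  have h1 := homotopy_of_cycle hG k l _ fun j => d_boundary k j l w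
  have h2 := congrArg (boundary G k l) (homotopy_succ hG k l w)
  rw [map_add, map_add, boundary_boundary, boundary_spanInclusion hG, zero_add, add_zero] at h2
  rw [h2, add_eq_left] at h1
  rw [← spanProjection_inclusion (IsCritical G k l) (spanProjection _ _), h1, map_zero]

theorem exists_basis_treeMatching (hG : G.IsTree) (k l : ℕ) :
    ∃ B : Module.Basis {x : Idx G k l // Unmatched (treeMatching G) x.1} ℤ (MH G k l),
      ∀ x, IsHomologyClass G (Finsupp.single x.1 1) (B x) := by
  refine exists_basis (IsCritical G k l) (homotopy G k l) (fun j x hx => ?_)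
    (homotopy_of_cycle hG k l) (spanProjection_boundary hG k l)
  by_cases hj : j + 1 = k
  · subst hj
    rw [magnitudeComplex_d, single_eq_gen]
    exact boundary_gen_of_isIdle hG ((isCritical_iff hG x).1 hx) x.2
  · rw [(magnitudeComplex G l).shape k j (by simpa using hj)]
    rfl

/-! ### Degrees of the unmatched sequences and diagonality -/

theorem natLength_alternating {u v : V} (h : G.Adj u v) (k : ℕ) :
    natLength G (alternating u v k) = k := by
  induction k generalizing u v with
  | zero => rfl
  | succ k ih =>
    have := ih h.symm
    cases k with
    | zero => simp [alternating, natLength, h]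
    | succ k =>
      rw [alternating] at this ⊢
      rw [alternating, natLength, this, SimpleGraph.dist_eq_one_iff_adj.2 h, add_comm]

theorem length_alternating (u v : V) (k : ℕ) : (alternating u v k).length = k + 1 := by
  induction k generalizing u v with
  | zero => rfl
  | succ k ih => rw [alternating, List.length_cons, ih]

theorem eq_of_isIdle_of_isIndex (hG : G.IsTree) {k l : ℕ} {x : List V} (hx : IsIndex G k l x)
    (h : IsIdle G x) : k = l := by
  obtain ⟨h1, -, h2⟩ := (isIndex_iff hG.connected).1 hx
  rcases eq_alternating_of_isIdle hG ⟨k, l, hx⟩ h with ⟨v, rfl⟩ | ⟨u, v, m, huv, -, rfl⟩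
  · simp only [List.length_singleton, natLength] at h1 h2
    omega
  · rw [length_alternating] at h1
    rw [natLength_alternating huv] at h2
    omega

/-- Nontrivial homology has a nonempty basis, hence an idle sequence in bidegree `(k, l)`; all `k`
of its steps have length 1. -/
theorem isDiagonal_of_isTree (hG : G.IsTree) : IsDiagonal G := by
  intro k l hn
  obtain ⟨B, -⟩ := exists_basis_treeMatching hG k l
  obtain ⟨x⟩ := B.index_nonempty
  exact eq_of_isIdle_of_isIndex hG x.1.2 ((isCritical_iff hG x.1).1 x.2)

end MagnitudeTree

theorem mainTheorem5 {V : Type*} [Finite V] (G : SimpleGraph V) (hG : G.IsTree) :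
    -- the tree is diagonal
    MagnitudeTree.IsDiagonal G ∧
    -- the first step of the geodesic is well defined
    (∀ u v, 2 ≤ G.dist u v → ∃! w, MagnitudeTree.IsFirstStep G u v w) ∧
    -- the matching rule built from it is valid and diagonal, and generates a prefix matching
    MagnitudeTree.IsDiagonalRule G (MagnitudeTree.treeRule G) ∧
    (∃! M : List V → List V → Prop, MagnitudeTree.IsPrefixMatching G M ∧
      MagnitudeTree.IsGeneratedBy G (MagnitudeTree.treeRule G) M) ∧
    ∀ M : List V → List V → Prop, MagnitudeTree.IsPrefixMatching G M →
      MagnitudeTree.IsGeneratedBy G (MagnitudeTree.treeRule G) M →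
      -- the rule on a sequence with unmatched, respectively matched, prefix
      (∀ (p : List V) (b : V), MagnitudeTree.IsSeq G (p ++ [b]) →
        (MagnitudeTree.Unmatched M p →
          MagnitudeTree.treeRule G (p ++ [b]) = MagnitudeTree.treeRuleStep G (p ++ [b])) ∧
        (¬ MagnitudeTree.Unmatched M p → MagnitudeTree.treeRule G (p ++ [b]) = .idle)) ∧
      -- the matching is a Morse matching
      MagnitudeTree.IsMorseMatching G M ∧
      -- the unmatched sequences
      {x : List V | MagnitudeTree.IsSeq G x ∧ MagnitudeTree.Unmatched M x} =
        {x | ∃ v, x = [v]} ∪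
          {x | ∃ u v k, G.Adj u v ∧ 1 ≤ k ∧ x = MagnitudeTree.alternating u v k} ∧
      -- their homology classes form a basis of the magnitude homology
      ∀ k l : ℕ, ∃ B : Module.Basis
          {x : MagnitudeTree.Idx G k l // MagnitudeTree.Unmatched M x.1} ℤ
          (MagnitudeTree.MH G k l),
        ∀ x, MagnitudeTree.IsHomologyClass G (Finsupp.single x.1 1) (B x) := by
  refine ⟨MagnitudeTree.isDiagonal_of_isTree hG, fun u v h => ?_,
    MagnitudeTree.isDiagonalRule_treeRule hG,
    ⟨MagnitudeTree.treeMatching G, ⟨MagnitudeTree.isPrefixMatching_treeMatching hG,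
      MagnitudeTree.isGeneratedBy_treeMatching hG⟩,
      fun M hM => MagnitudeTree.eq_treeMatching hG hM.1 hM.2⟩, fun M hM hMF => ?_⟩
  · exact ⟨_, MagnitudeTree.isFirstStep_firstStep hG.connected
      (MagnitudeTree.ne_of_two_le_dist h), fun w hw => hw.unique hG
        (MagnitudeTree.isFirstStep_firstStep hG.connected (MagnitudeTree.ne_of_two_le_dist h))⟩
  · rw [MagnitudeTree.eq_treeMatching hG hM hMF]
    exact ⟨fun p b hx => MagnitudeTree.treeRule_append_singleton_of_isSeq hG hx,
      MagnitudeTree.isMorseMatching_treeMatching hG, MagnitudeTree.unmatched_eq hG,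
      MagnitudeTree.exists_basis_treeMatching hG⟩
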